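/- **Theorem 4.4.** For bounded real sequences $\alpha=(\alpha_n)_{n\in\mathbb Z}$, $\beta=(\beta_n)_{n\in\mathbb Z}$ let $J(\alpha,\beta)$ be the bounded selfadjoint operator on $\ell^2(\mathbb Z)$ given by $(J(\alpha,\beta)\varphi)_n=\alpha_n\varphi_{n+1}+\beta_n\varphi_n+\alpha_{n-1}\varphi_{n-1}$. Let $J_0=J(a^{(0)},b^{(0)})$ be a two-sided Jacobi matrix, with $a^{(0)},b^{(0)}$ bounded and all $a^{(0)}_n>0$. Suppose that for some real $a<b$: (i) $[a,b)\cap\sigma(J_0)=\emptyset$. (ii) There are $\varepsilon,\delta>0$, measurable functions $\rho,\theta,E$ from $(-\delta,\delta)$ to $\mathbb R$, measurable functions $u_n:(-\delta,\delta)\to\mathbb C$ $(n\in\mathbb Z)$, and a linear map $\varphi\mapsto\widetilde\varphi$ from the range of the spectral projection $P_{[b,b+\varepsilon)}(J_0)$ to $L^2((-\delta,\delta),dk)$ such that for all $\varphi\in\operatorname{ran}P_{[b,b+\varepsilon)}(J_0)$ $$\varphi_n=\int_{-\delta}^{\delta}\widetilde\varphi(k)\,u_n(k)\,dk\quad(n\in\mathbb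 Z),\qquad \widetilde{J_0\varphi}(k)=E(k)\,\widetilde\varphi(k)\ \text{ for a.e. }k,\qquad \|\varphi\|^2=\int_{-\delta}^{\delta}|\widetilde\varphi(k)|^2\rho(k)\,dk .$$ Moreover, for every $f\in L^2((-\delta,\delta),dk)$ the sequence $\varphi_n=\int_{-\delta}^{\delta}f(k)u_n(k)\,dk$ is an element of $\operatorname{ran}P_{[b,b+\varepsilon)}(J_0)$. (iii) There are constants with $0<\rho_-\le\rho(k)\le\rho_+<\infty$ for all $k\in(-\delta,\delta)$. (iv) $E$ maps $[0,\delta)$ into $[b,b+\varepsilon)$, and for some $c_1>0$, $E(k)\ge b+c_1k^2$ for all $k\in(-\delta,\delta)$. (v) $\sup_{k\in(-\delta,\delta),\,n\in\mathbb Z}|u_n(k)|<\infty$. (vi) With $v_n(k)=e^{-i\theta(k)n}u_n(k)$, there is $c_3<\infty$ with $|v_n(k)-v_n(0)|\le c_3k^2$ for all $n\in\mathbb Z$ and $k\in(-\delta,\delta)$. (vii) $\theta$ is $C^2$ on $(-\delta,\delta)$ and $\inf_{k\in(-\delta,\delta)}\theta'(k)>0$. (viii) $E(-k)=E(k)$,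 $u_n(-k)=\overline{u_n(k)}$, $\theta(-k)=-\theta(k)$, $\rho(-k)=\rho(k)$ for all $k\in(-\delta,\delta)$ and $n\in\mathbb Z$. Then there is a finite constant $C$ such that for all bounded real sequences $(\delta a_n)_{n\in\mathbb Z}$, $(\delta b_n)_{n\in\mathbb Z}$, with $\delta J=J(\delta a,\delta b)$, $$\sum_{e\in\sigma_{\mathrm d}(J_0+\delta J)\cap(a,b)}(b-e)^{1/2}\ \le\ C\sum_{n=-\infty}^{\infty}\bigl(|\delta a_n|+|\delta b_n|\bigr),$$ where the discrete spectrum $\sigma_{\mathrm d}$ consists of the isolated points of the spectrum that have a finite-dimensional eigenspace, and each $e$ is counted in the sum with its multiplicity as an eigenvalue. (The right-hand side may be $+\infty$; if it is finite, then so is the left-hand side.) -/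

import Mathlib

open MeasureTheory Set
open scoped ENNReal NNReal

/-- The complex Hilbert space `ℓ²(ℤ)`. -/
abbrev EllTwo : Type := lp (fun _ : ℤ => ℂ) 2

/-- A real two-sided sequence is bounded. -/
def BddSeq (d : ℤ → ℝ) : Prop := ∃ M : ℝ, ∀ n, |d n| ≤ M

theorem memlp_translate (s : ℤ) (φ : EllTwo) : Memℓp (fun n : ℤ => φ (n + s)) 2 := by
  have h := (lp.memℓp φ).summable (by norm_num)
  exact memℓp_gen ((Equiv.addRight s).summable_iff.mpr h)

/-- The translation `(S φ) n = φ (n + s)` on `ℓ²(ℤ)`. -/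
noncomputable def translateOp (s : ℤ) : EllTwo →L[ℂ] EllTwo :=
  LinearMap.mkContinuous
    { toFun := fun φ => ⟨fun n => φ (n + s), memlp_translate s φ⟩
      map_add' := fun _ _ => rfl
      map_smul' := fun _ _ => rfl } 1 (by
    intro φ
    refine lp.norm_le_of_tsum_le (by norm_num) (by positivity) ?_
    rw [one_mul, lp.norm_rpow_eq_tsum (by norm_num) φ]
    exact ((Equiv.addRight s).tsum_eq (fun n => ‖φ n‖ ^ (2 : ℝ≥0∞).toReal)).le)

theorem memlp_diag (d : ℤ → ℝ) (hd : BddSeq d) (φ : EllTwo) :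
    Memℓp (fun n : ℤ => (d n : ℂ) * φ n) 2 := by
  obtain ⟨M, hM⟩ := hd
  refine ((lp.memℓp φ).const_mul (M : ℂ)).mono' fun n => ?_
  have := le_abs_self M
  simp only [norm_mul, Complex.norm_real, Real.norm_eq_abs]
  exact mul_le_mul_of_nonneg_right ((hM n).trans this) (norm_nonneg _)

/-- Multiplication `(D φ) n = d n * φ n` on `ℓ²(ℤ)` by a bounded real sequence `d`. -/
noncomputable def diagOp (d : ℤ → ℝ) (hd : BddSeq d) : EllTwo →L[ℂ] EllTwo :=
  LinearMap.mkContinuousOfExistsBound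
    { toFun := fun φ => ⟨fun n => (d n : ℂ) * φ n, memlp_diag d hd φ⟩
      map_add' := fun φ ψ => by
        ext n
        exact mul_add _ _ _
      map_smul' := fun c φ => by
        ext n
        exact mul_left_comm _ _ _ } (by
    obtain ⟨M, hM⟩ := hd
    refine ⟨‖(M : ℂ)‖, fun φ => ?_⟩
    rw [← norm_smul]
    refine lp.norm_mono (by norm_num) fun n => ?_
    simp only [LinearMap.coe_mk, AddHom.coe_mk, lp.coeFn_smul, Pi.smul_apply, smul_eq_mul,
      norm_mul, Complex.norm_real, Real.norm_eq_abs]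
    exact mul_le_mul_of_nonneg_right ((hM n).trans (le_abs_self M)) (norm_nonneg _))

/-- The bounded two-sided Jacobi matrix with off-diagonal entries `a n` (in position `(n, n + 1)`
and `(n + 1, n)`) and diagonal entries `b n`, as an operator on `ℓ²(ℤ)`. -/
noncomputable def jacobiOp (a b : ℤ → ℝ) (ha : BddSeq a) (hb : BddSeq b) : EllTwo →L[ℂ] EllTwo :=
  diagOp a ha ∘L translateOp 1 + diagOp b hb + translateOp (-1) ∘L diagOp a ha

theorem jacobiOp_apply (a b : ℤ → ℝ) (ha : BddSeq a) (hb : BddSeq b) (φ : EllTwo) (n : ℤ) :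
    jacobiOp a b ha hb φ n =
      (a n : ℂ) * φ (n + 1) + (b n : ℂ) * φ n + (a (n - 1) : ℂ) * φ (n - 1) :=
  rfl

section SpectralNotions

variable {H : Type*} [NormedAddCommGroup H] [InnerProductSpace ℂ H] [CompleteSpace H]

/-- For a bounded selfadjoint operator `A`, the range of the spectral projection `P_{[c,∞)}(A)`:
the null space of the negative part `(A - c)₋ = max(c - A, 0)`. -/
noncomputable def spectralRangeIci (A : H →L[ℂ] H) (c : ℝ) : Submodule ℂ H :=
  LinearMap.ker (cfc (fun x : ℝ => max (c - x) 0) A : H →L[ℂ] H).toLinearMap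

/-- For a bounded selfadjoint operator `A`, the range of the spectral projection `P_{[c,d)}(A)`.
It is the intersection of the ranges of `P_{[c,∞)}(A)` and of `P_{(-∞,d)}(A) = 1 - P_{[d,∞)}(A)`. -/
noncomputable def spectralRangeIco (A : H →L[ℂ] H) (c d : ℝ) : Submodule ℂ H :=
  spectralRangeIci A c ⊓ (spectralRangeIci A d)ᗮ

/-- The multiplicity of `e` as an eigenvalue of `A`, i.e. the dimension of the eigenspace. -/
noncomputable def eigenMultiplicity (A : H →L[ℂ] H) (e : ℝ) : ℕ :=
  Module.finrank ℂ (Module.End.eigenspace A.toLinearMap (e : ℂ))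

/-- The discrete spectrum of a bounded selfadjoint operator `A`: the isolated points of the
spectrum whose eigenspace is finite-dimensional. -/
def discreteSpectrum (A : H →L[ℂ] H) : Set ℝ :=
  {e | e ∈ spectrum ℝ A ∧ (∃ r > 0, ∀ x ∈ spectrum ℝ A, |x - e| < r → x = e) ∧
    FiniteDimensional ℂ (Module.End.eigenspace A.toLinearMap (e : ℂ))}

end SpectralNotions

/-! Take finitely many eigenvalues `e` of `J₀ + δJ` in `(a, b)`, with multiplicity, and let `N(t)`
count those with `(b - e)^{1/2} ≥ t`. Their sum `∑ (b - e)^{1/2}` is the integral of `N` over `(0,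
(b - a)^{1/2})`. Hence it suffices to find `M` functionals and a list of weighted functionals `(y_j,
χ_j)`, none depending on `t`, with `M` and `∑ y_j` at most a constant times the `ℓ¹` size of the
perturbation and `N(t) ≤ M + #{j : y_j ≥ t}`. `sum_le_of_card_filter_le` integrates this count.

The count is a dimension argument. On the common kernel of the functionals in force at level `t`,
each vector splits orthogonally as `p + q`, where the form of `J₀ + δJ` is below `a` on `p` and
above `b - t²` on `q`. By `eq_zero_of_sum_eigenvectors`, no nonzero combination of eigenvectors with
eigenvalues in `(a, b - t²]` has such a splitting.

The form of `δJ` is dominated by a diagonal potential `d ≥ 0` with `∑ d` controlled by the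
perturbation. On the spectral subspaces of `J₀` below `a` and above `b + ε` there is a fixed margin,
and the trace bound `exists_orthogonal_tsum_le` makes the potential smaller than this margin at the
cost of `O(∑ d)` functionals. Near `b` the energy above `b` controls `∫ k² |F(k)|² dk`, where `F` is
the transform. There `u_n(k)` is replaced by `v_n(0) exp(i n θ(k))`; the remainder divided by `k` is
bounded, so it again costs only `O(∑ d)` functionals. For the plane-wave part, Bessel's inequality
in the variable `θ` bounds `∑ |ψ_n|²` by `∫ |F|²` and `∑ |ψ_{n+1} - ψ_n|²` by `∫ k² |F|²`. This
reduces the problem to a Lieb–Thirring bound of power 1/2 for the discrete Laplacian,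
`exists_list_sum_mul_norm_sq_le`, proved by cutting `ℤ` into blocks adapted to `d`. -/

/-! ### Dimension counting and forms of finite trace -/

theorem exists_ne_zero_forall_eq_zero {ι κ H : Type*} [Fintype ι] [Fintype κ] [AddCommGroup H]
    [Module ℂ H] (φ : ι → H) (g : κ → H →ₗ[ℂ] ℂ) (hcard : Fintype.card κ < Fintype.card ι) :
    ∃ x : ι → ℂ, x ≠ 0 ∧ ∀ j, g j (∑ i, x i • φ i) = 0 := by
  let L : (ι → ℂ) →ₗ[ℂ] (κ → ℂ) := LinearMap.pi fun j => g j ∘ₗ Fintype.linearCombination ℂ φ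
  have hker : LinearMap.ker L ≠ ⊥ := LinearMap.ker_ne_bot_of_finrank_lt (by simpa using hcard)
  obtain ⟨x, hx, hx0⟩ := (Submodule.ne_bot_iff _).1 hker
  refine ⟨x, hx0, fun j => ?_⟩
  have := congrFun (LinearMap.mem_ker.1 hx) j
  simpa [L, Fintype.linearCombination_apply] using this

/-- A nonnegative quadratic form with trace at most `τ` is bounded by `η` on the orthogonal
complement of at most `τ / η` vectors. -/
theorem exists_orthogonal_le_of_trace_le {H : Type*} [NormedAddCommGroup H]
    [InnerProductSpace ℂ H] (q : H → ℝ) (hq : ∀ (c : ℂ) (h : H), q (c • h) = ‖c‖ ^ 2 * q h)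
    {τ η : ℝ} (hη : 0 < η)
    (htr : ∀ (n : ℕ) (f : Fin n → H), Orthonormal ℂ f → ∑ i, q (f i) ≤ τ) :
    ∃ (n : ℕ) (f : Fin n → H), (n : ℝ) * η ≤ τ ∧
      ∀ h, (∀ i, inner ℂ (f i) h = 0) → q h ≤ η * ‖h‖ ^ 2 := by
  classical
  -- Take an orthonormal family of maximal length on which `q ≥ η`; the trace bounds its length, and
  -- a vector violating the conclusion would, once normalized, extend it.
  let p : ℕ → Prop := fun n => ∃ f : Fin n → H, Orthonormal ℂ f ∧ ∀ i, η ≤ q (f i)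
  have hp0 : p 0 := ⟨Fin.elim0, ⟨fun i => i.elim0, fun i => i.elim0⟩, fun i => i.elim0⟩
  have hbound : ∀ n, p n → (n : ℝ) * η ≤ τ := by
    rintro n ⟨f, hf, hfη⟩
    calc (n : ℝ) * η = ∑ _i : Fin n, η := by simp
      _ ≤ ∑ i, q (f i) := Finset.sum_le_sum fun i _ => hfη i
      _ ≤ τ := htr n f hf
  have hbound' : ∀ n, p n → n ≤ ⌊τ / η⌋₊ := fun n hn =>
    Nat.le_floor ((le_div_iff₀ hη).2 (hbound n hn))
  have hpn := Nat.findGreatest_spec (P := p) (Nat.zero_le ⌊τ / η⌋₊) hp0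
  set n := Nat.findGreatest p ⌊τ / η⌋₊ with hn
  obtain ⟨f, hf, hfη⟩ := hpn
  refine ⟨n, f, hbound n ⟨f, hf, hfη⟩, fun h hh => ?_⟩
  by_contra! hlt
  have hh0 : h ≠ 0 := by
    rintro rfl
    have := hq 0 0
    simp only [zero_smul, norm_zero] at this hlt
    norm_num at this hlt
    linarith
  have hnorm : 0 < ‖h‖ := norm_pos_iff.2 hh0
  let w : H := ((‖h‖⁻¹ : ℝ) : ℂ) • h
  have hw : ‖w‖ = 1 := by
    simp only [w, norm_smul, Complex.norm_real, norm_inv, norm_norm]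
    exact inv_mul_cancel₀ hnorm.ne'
  have hqw : η ≤ q w := by
    simp only [w, hq, Complex.norm_real, norm_inv, norm_norm]
    rw [inv_pow, ← div_eq_inv_mul, le_div_iff₀ (by positivity)]
    exact hlt.le
  have hwf : ∀ i, inner ℂ (f i) w = 0 := fun i => by simp [w, hh i]
  have hp : p (n + 1) := by
    refine ⟨Fin.cons w f, ⟨?_, ?_⟩, ?_⟩
    · intro i
      refine Fin.cases ?_ (fun j => ?_) i
      · simpa using hw
      · simpa using hf.1 j
    · intro i j
      refine Fin.cases ?_ (fun i => ?_) i <;> refine Fin.cases ?_ (fun j => ?_) j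
      · simp
      · intro _
        simpa using inner_eq_zero_symm.1 (hwf j)
      · intro _
        simpa using hwf i
      · intro hij
        simpa using hf.2 (fun h => hij (congrArg Fin.succ h))
    · intro i
      refine Fin.cases ?_ (fun j => ?_) i
      · simpa using hqw
      · simpa using hfη j
  have := Nat.le_findGreatest (hbound' _ hp) hp
  omega

/-- By Bessel's inequality the form `∑ d n |⟪g n, h⟫|²` has trace at most `∑ d n ‖g n‖²`. This
handles the potential wherever a fixed energy margin is available. -/
theorem exists_orthogonal_tsum_le {H : Type*} [NormedAddCommGroup H]
    [InnerProductSpace ℂ H] {d : ℤ → ℝ} (hd : ∀ n, 0 ≤ d n) (hds : Summable d) (g : ℤ → H)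
    {K : ℝ} (hg : ∀ n, ‖g n‖ ^ 2 ≤ K) {η : ℝ} (hη : 0 < η) :
    ∃ (n : ℕ) (f : Fin n → H), (n : ℝ) * η ≤ K * ∑' n, d n ∧
      ∀ h, (∀ i, inner ℂ (f i) h = 0) → ∑' n, d n * ‖inner ℂ (g n) h‖ ^ 2 ≤ η * ‖h‖ ^ 2 := by
  have hsum : ∀ h : H, Summable fun n => d n * ‖inner ℂ (g n) h‖ ^ 2 := by
    intro h
    refine Summable.of_nonneg_of_le (fun n => mul_nonneg (hd n) (by positivity)) (fun n => ?_)
      (hds.mul_right (K * ‖h‖ ^ 2))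
    refine mul_le_mul_of_nonneg_left ?_ (hd n)
    calc ‖inner ℂ (g n) h‖ ^ 2 ≤ (‖g n‖ * ‖h‖) ^ 2 := by gcongr; exact norm_inner_le_norm _ _
      _ = ‖g n‖ ^ 2 * ‖h‖ ^ 2 := by ring
      _ ≤ K * ‖h‖ ^ 2 := by gcongr; exact hg n
  refine exists_orthogonal_le_of_trace_le (fun h => ∑' n, d n * ‖inner ℂ (g n) h‖ ^ 2) ?_ hη ?_
  · intro c h
    rw [← tsum_mul_left]
    refine tsum_congr fun n => ?_
    rw [inner_smul_right, norm_mul]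
    ring
  · intro N f hf
    rw [← Summable.tsum_finsetSum fun i _ => hsum (f i), ← tsum_mul_left]
    refine Summable.tsum_le_tsum (fun n => ?_) (summable_sum fun i _ => hsum (f i))
      (hds.mul_left K)
    rw [← Finset.mul_sum, mul_comm K]
    refine mul_le_mul_of_nonneg_left ?_ (hd n)
    refine le_trans ?_ (hg n)
    refine le_trans (le_of_eq ?_) (hf.sum_inner_products_le (g n) (s := Finset.univ))
    exact Finset.sum_congr rfl fun i _ => by rw [norm_inner_symm]

/-! ### Layer-cake summation -/

theorem antitone_indicator_le (z : ℝ) : Antitone fun t : ℝ => if t ≤ z then (1 : ℝ) else 0 := by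
  intro t u htu
  by_cases hu : u ≤ z
  · simp [hu, htu.trans hu]
  · simp only [if_neg hu]
    split_ifs <;> norm_num

theorem integral_indicator_le {z R : ℝ} (hz : 0 ≤ z) (hzR : z ≤ R) :
    ∫ t in (0 : ℝ)..R, (if t ≤ z then (1 : ℝ) else 0) = z := by
  have hanti := antitone_indicator_le z
  rw [← intervalIntegral.integral_add_adjacent_intervals (b := z) hanti.intervalIntegrable
    hanti.intervalIntegrable]
  have h1 : ∫ t in (0 : ℝ)..z, (if t ≤ z then (1 : ℝ) else 0) = ∫ _t in (0 : ℝ)..z, (1 : ℝ) := by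
    refine intervalIntegral.integral_congr fun t ht => ?_
    rw [uIcc_of_le hz] at ht
    simp [ht.2]
  have h2 : ∫ t in z..R, (if t ≤ z then (1 : ℝ) else 0) = ∫ _t in z..R, (0 : ℝ) := by
    refine intervalIntegral.integral_congr_ae (Filter.Eventually.of_forall fun t ht => ?_)
    rw [uIoc_of_le hzR] at ht
    simp [ht.1]
  rw [h1, h2]
  simp

theorem integral_indicator_le_le {z R : ℝ} (hz : 0 ≤ z) (hR : 0 ≤ R) :
    ∫ t in (0 : ℝ)..R, (if t ≤ z then (1 : ℝ) else 0) ≤ z := by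
  rcases le_total z R with h | h
  · exact (integral_indicator_le hz h).le
  · calc _ ≤ ∫ _t in (0 : ℝ)..R, (1 : ℝ) := by
          refine intervalIntegral.integral_mono_on hR
            (antitone_indicator_le z).intervalIntegrable (by simp) ?_
          intro t _
          split_ifs <;> norm_num
      _ ≤ z := by simpa using h

/-- Integrate the counting inequality over `t ∈ (0, R)`: the indicator of `t ≤ x i` integrates to `x
i` because `x i ≤ R`, and that of `t ≤ y j` to at most `y j`. -/
theorem sum_le_of_card_filter_le {ι κ : Type*} (s : Finset ι) (x : ι → ℝ) (S : Finset κ)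
    (y : κ → ℝ) {m R : ℝ} (hR : 0 ≤ R) (hx : ∀ i ∈ s, 0 ≤ x i ∧ x i ≤ R) (hy : ∀ j ∈ S, 0 ≤ y j)
    (hcount : ∀ t, 0 < t → ((s.filter fun i => t ≤ x i).card : ℝ) ≤
      m + (S.filter fun j => t ≤ y j).card) :
    ∑ i ∈ s, x i ≤ m * R + ∑ j ∈ S, y j := by
  have hint : ∀ z : ℝ, IntervalIntegrable (fun t => if t ≤ z then (1 : ℝ) else 0) volume 0 R :=
    fun z => (antitone_indicator_le z).intervalIntegrable
  have hsumx : IntervalIntegrable (fun t => ∑ i ∈ s, if t ≤ x i then (1 : ℝ) else 0) volume 0 R := by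
    have := IntervalIntegrable.sum s fun i _ => hint (x i)
    rwa [Finset.sum_fn] at this
  have hsumy : IntervalIntegrable (fun t => ∑ j ∈ S, if t ≤ y j then (1 : ℝ) else 0) volume 0 R := by
    have := IntervalIntegrable.sum S fun j _ => hint (y j)
    rwa [Finset.sum_fn] at this
  have hm : IntervalIntegrable (fun _ => m) volume 0 R := by simp
  calc ∑ i ∈ s, x i = ∑ i ∈ s, ∫ t in (0 : ℝ)..R, (if t ≤ x i then (1 : ℝ) else 0) :=
        Finset.sum_congr rfl fun i hi => (integral_indicator_le (hx i hi).1 (hx i hi).2).symm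
    _ = ∫ t in (0 : ℝ)..R, ∑ i ∈ s, (if t ≤ x i then (1 : ℝ) else 0) :=
        (intervalIntegral.integral_finsetSum fun i _ => hint _).symm
    _ ≤ ∫ t in (0 : ℝ)..R, (m + ∑ j ∈ S, (if t ≤ y j then (1 : ℝ) else 0)) := by
        refine intervalIntegral.integral_mono_on_of_le_Ioo hR hsumx (hm.add hsumy) ?_
        intro t ht
        have := hcount t ht.1
        rw [Finset.card_filter, Finset.card_filter] at this
        push_cast at this
        exact this
    _ = m * R + ∑ j ∈ S, ∫ t in (0 : ℝ)..R, (if t ≤ y j then (1 : ℝ) else 0) := by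
        rw [intervalIntegral.integral_add hm hsumy,
          intervalIntegral.integral_finsetSum fun j _ => hint _,
          intervalIntegral.integral_const, sub_zero, smul_eq_mul, mul_comm]
    _ ≤ m * R + ∑ j ∈ S, y j := by
        gcongr with j hj
        exact integral_indicator_le_le (hy j hj) hR

/-! ### Potentials against the discrete Laplacian -/

theorem norm_sub_sq_le_mul_sum_grad (ψ : ℤ → ℂ) (m : ℤ) (L : ℕ) {i j : ℤ}
    (hi : i ∈ Finset.Ico m (m + L)) (hj : j ∈ Finset.Ico m (m + L)) :
    ‖ψ i - ψ j‖ ^ 2 ≤ L * ∑ n ∈ Finset.Ico m (m + L), ‖ψ (n + 1) - ψ n‖ ^ 2 := by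
  wlog hij : j ≤ i generalizing i j with H
  · rw [norm_sub_rev]
    exact H hj hi (le_of_not_ge hij)
  rw [Finset.mem_Ico] at hi hj
  obtain ⟨k, rfl⟩ := Int.le.dest hij
  have tele : ψ (j + k) - ψ j = ∑ n ∈ Finset.range k, (ψ (j + n + 1) - ψ (j + n)) := by
    have := Finset.sum_range_sub (fun n : ℕ => ψ (j + n)) k
    simp only [Nat.cast_add, Nat.cast_one, Nat.cast_zero, add_zero, ← add_assoc] at this
    exact this.symm
  have hk : (k : ℝ) ≤ L := by
    have : (k : ℤ) ≤ L := by omega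
    exact_mod_cast this
  have hsum : ∑ n ∈ Finset.range k, ‖ψ (j + n + 1) - ψ (j + n)‖ ^ 2 ≤
      ∑ n ∈ Finset.Ico m (m + L), ‖ψ (n + 1) - ψ n‖ ^ 2 := by
    have himg : ∑ n ∈ (Finset.range k).image (fun n : ℕ => j + (n : ℤ)), ‖ψ (n + 1) - ψ n‖ ^ 2 =
        ∑ n ∈ Finset.range k, ‖ψ (j + n + 1) - ψ (j + n)‖ ^ 2 :=
      Finset.sum_image fun x _ y _ hxy => by simpa using hxy
    rw [← himg]
    refine Finset.sum_le_sum_of_subset_of_nonneg ?_ fun _ _ _ => by positivity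
    intro n hn
    obtain ⟨x, hx, rfl⟩ := Finset.mem_image.1 hn
    have := Finset.mem_range.1 hx
    rw [Finset.mem_Ico]
    constructor <;> omega
  calc ‖ψ (j + k) - ψ j‖ ^ 2
      ≤ (∑ n ∈ Finset.range k, ‖ψ (j + n + 1) - ψ (j + n)‖) ^ 2 := by
        rw [tele]; gcongr; exact norm_sum_le _ _
    _ ≤ k * ∑ n ∈ Finset.range k, ‖ψ (j + n + 1) - ψ (j + n)‖ ^ 2 := by
        simpa using sq_sum_le_card_mul_sum_sq (s := Finset.range k)
          (f := fun n : ℕ => ‖ψ (j + n + 1) - ψ (j + n)‖)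
    _ ≤ _ := by gcongr

/-- The normalized mean `L^{-1/2} ∑_{m ≤ n < m + L} ψ n`. -/
noncomputable def blockMean (m : ℤ) (L : ℕ) : (ℤ → ℂ) →ₗ[ℂ] ℂ :=
  (((Real.sqrt L)⁻¹ : ℝ) : ℂ) • ∑ n ∈ Finset.Ico m (m + L), LinearMap.proj n

theorem norm_blockMean_sq (m : ℤ) (L : ℕ) (ψ : ℤ → ℂ) :
    ‖blockMean m L ψ‖ ^ 2 = (L : ℝ)⁻¹ * ‖∑ n ∈ Finset.Ico m (m + L), ψ n‖ ^ 2 := by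
  simp only [blockMean, LinearMap.smul_apply, LinearMap.sum_apply, LinearMap.proj_apply,
    smul_eq_mul, norm_mul, mul_pow, Complex.norm_real, norm_inv, Real.norm_eq_abs, sq_abs, inv_pow]
  rw [Real.sq_sqrt (Nat.cast_nonneg L)]

theorem norm_blockMean_sq_le (m : ℤ) (L : ℕ) (ψ : ℤ → ℂ) :
    ‖blockMean m L ψ‖ ^ 2 ≤ ∑ n ∈ Finset.Ico m (m + L), ‖ψ n‖ ^ 2 := by
  rw [norm_blockMean_sq]
  rcases Nat.eq_zero_or_pos L with rfl | hL
  · simp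
  have hL' : (0 : ℝ) < L := by exact_mod_cast hL
  rw [inv_mul_le_iff₀ hL']
  calc _ ≤ (∑ n ∈ Finset.Ico m (m + L), ‖ψ n‖) ^ 2 := by gcongr; exact norm_sum_le _ _
    _ ≤ _ := by
      simpa using sq_sum_le_card_mul_sum_sq (s := Finset.Ico m (m + L)) (f := fun n => ‖ψ n‖)

/-- A discrete Poincaré inequality: a value differs from the block average by at most the root of
block length times gradient energy. -/
theorem norm_sq_le_blockMean_add_grad (ψ : ℤ → ℂ) (m : ℤ) (L : ℕ) {i : ℤ}
    (hi : i ∈ Finset.Ico m (m + L)) :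
    ‖ψ i‖ ^ 2 ≤ 2 / L * ‖blockMean m L ψ‖ ^ 2 +
      2 * L * ∑ n ∈ Finset.Ico m (m + L), ‖ψ (n + 1) - ψ n‖ ^ 2 := by
  set G := ∑ n ∈ Finset.Ico m (m + L), ‖ψ (n + 1) - ψ n‖ ^ 2 with hG
  have hG0 : 0 ≤ G := Finset.sum_nonneg fun _ _ => by positivity
  have hL : 0 < L := by
    rw [Finset.mem_Ico] at hi
    omega
  have hL' : (0 : ℝ) < L := by exact_mod_cast hL
  set M := ∑ n ∈ Finset.Ico m (m + L), ψ n with hM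
  have hdiff : ‖(L : ℂ) * ψ i - M‖ ≤ L * Real.sqrt (L * G) := by
    have : (L : ℂ) * ψ i - M = ∑ n ∈ Finset.Ico m (m + L), (ψ i - ψ n) := by
      rw [Finset.sum_sub_distrib, Finset.sum_const, hM]
      simp
    rw [this]
    calc _ ≤ ∑ n ∈ Finset.Ico m (m + L), ‖ψ i - ψ n‖ := norm_sum_le _ _
      _ ≤ ∑ n ∈ Finset.Ico m (m + L), Real.sqrt (L * G) := by
        refine Finset.sum_le_sum fun n hn => Real.le_sqrt_of_sq_le ?_
        exact norm_sub_sq_le_mul_sum_grad ψ m L hi hn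
      _ = _ := by simp
  have h1 : (L : ℝ) * ‖ψ i‖ ≤ ‖M‖ + L * Real.sqrt (L * G) := by
    have := norm_sub_norm_le ((L : ℂ) * ψ i) M
    rw [norm_mul, Complex.norm_natCast] at this
    linarith
  have h2 : ((L : ℝ) * ‖ψ i‖) ^ 2 ≤ 2 * ‖M‖ ^ 2 + 2 * (L ^ 2 * (L * G)) := by
    calc _ ≤ (‖M‖ + L * Real.sqrt (L * G)) ^ 2 := by gcongr
      _ ≤ 2 * (‖M‖ ^ 2 + (L * Real.sqrt (L * G)) ^ 2) := add_sq_le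
      _ = _ := by rw [mul_pow, Real.sq_sqrt (by positivity)]; ring
  rw [norm_blockMean_sq, ← hM]
  have h3 : ‖ψ i‖ ^ 2 = ((L : ℝ) * ‖ψ i‖) ^ 2 / L ^ 2 := by field_simp
  rw [h3, div_le_iff₀ (by positivity)]
  refine h2.trans (le_of_eq ?_)
  field_simp

/-- Summing the pointwise Poincaré bound against `d` gives the gradient the coefficient `2 (∑ d)
L'`, at most 1 on a short enough block. The block of length `L'` may exceed the window carrying `d`;
the last block of the partition needs this. -/
theorem sum_mul_norm_sq_le_blockMean {d : ℤ → ℝ} (hd : ∀ n, 0 ≤ d n) (ψ : ℤ → ℂ) (m : ℤ)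
    {L L' : ℕ} (hLL' : L ≤ L') (hs : 2 * (∑ n ∈ Finset.Ico m (m + L), d n) * L' ≤ 1) :
    ∑ n ∈ Finset.Ico m (m + L), d n * ‖ψ n‖ ^ 2 ≤
      ∑ n ∈ Finset.Ico m (m + L'), ‖ψ (n + 1) - ψ n‖ ^ 2 +
        2 * (∑ n ∈ Finset.Ico m (m + L), d n) / L' * ‖blockMean m L' ψ‖ ^ 2 := by
  set G := ∑ n ∈ Finset.Ico m (m + L'), ‖ψ (n + 1) - ψ n‖ ^ 2 with hG
  have hG0 : 0 ≤ G := Finset.sum_nonneg fun _ _ => by positivity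
  calc ∑ n ∈ Finset.Ico m (m + L), d n * ‖ψ n‖ ^ 2
      ≤ ∑ n ∈ Finset.Ico m (m + L), d n * (2 / L' * ‖blockMean m L' ψ‖ ^ 2 + 2 * L' * G) := by
        refine Finset.sum_le_sum fun n hn => mul_le_mul_of_nonneg_left ?_ (hd n)
        refine norm_sq_le_blockMean_add_grad ψ m L' ?_
        rw [Finset.mem_Ico] at hn ⊢
        omega
    _ = (2 * (∑ n ∈ Finset.Ico m (m + L), d n) * L') * G +
        2 * (∑ n ∈ Finset.Ico m (m + L), d n) / L' * ‖blockMean m L' ψ‖ ^ 2 := by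
        rw [← Finset.sum_mul]; ring
    _ ≤ _ := by nlinarith

theorem sum_Ico_add_cast {f : ℤ → ℝ} (m : ℤ) {l L : ℕ} (h : l ≤ L) :
    ∑ n ∈ Finset.Ico m (m + L), f n = ∑ n ∈ Finset.Ico m (m + l), f n +
      ∑ n ∈ Finset.Ico (m + l) (m + l + (L - l : ℕ)), f n := by
  have : m + l + ((L - l : ℕ) : ℤ) = m + L := by omega
  rw [this, ← Finset.sum_union]
  · congr 1
    ext x
    simp only [Finset.mem_union, Finset.mem_Ico]
    omega
  · exact Finset.Ico_disjoint_Ico_consecutive _ _ _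

theorem sqrt_two_mul_div_le {s : ℝ} {l : ℕ} (hl : 0 < l) (h : 2 * s * l ≤ 1) :
    Real.sqrt (2 * s / l) ≤ 1 / l := by
  have hl' : (0 : ℝ) < l := by exact_mod_cast hl
  refine Real.sqrt_le_iff.2 ⟨by positivity, ?_⟩
  rw [div_pow, div_le_div_iff₀ hl' (by positivity)]
  nlinarith

/-- A potential `d ≥ 0` on a finite interval of `ℤ` is bounded by the discrete Laplacian up to an
operator whose square root has trace at most `8 ∑ d`. -/
theorem exists_list_sum_mul_norm_sq_le {d : ℤ → ℝ} (hd : ∀ n, 0 ≤ d n) (L : ℕ) (m : ℤ) :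
    ∃ (L' : ℕ) (l : List (ℝ × ((ℤ → ℂ) →ₗ[ℂ] ℂ))), L ≤ L' ∧ (∀ x ∈ l, 0 ≤ x.1) ∧
      (∀ ψ : ℤ → ℂ, ∑ n ∈ Finset.Ico m (m + L), d n * ‖ψ n‖ ^ 2 ≤
        ∑ n ∈ Finset.Ico m (m + L'), ‖ψ (n + 1) - ψ n‖ ^ 2 +
          (l.map fun x => x.1 * ‖x.2 ψ‖ ^ 2).sum) ∧
      (∀ ψ : ℤ → ℂ, (l.map fun x => ‖x.2 ψ‖ ^ 2).sum ≤
        ∑ n ∈ Finset.Ico m (m + L'), ‖ψ n‖ ^ 2) ∧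
      (l.map fun x => Real.sqrt x.1).sum ≤
        4 * (2 * ∑ n ∈ Finset.Ico m (m + L), d n - if L = 0 then 0 else d m) := by
  -- Greedy partition: cut off the longest initial block with `2 · (∑ d) · length ≤ 1` and recurse.
  -- The cost of a block is paid by `d` on that block and on the first site of the next one; the
  -- term `- d m` in the bound accounts for this site being charged twice.
  induction L using Nat.strong_induction_on generalizing m with
  | _ L ih =>
  rcases Nat.eq_zero_or_pos L with rfl | hL
  · exact ⟨0, [], le_rfl, by simp, by simp, by simp, by simp⟩
  have hglue : ∀ (l₀ : ℕ) (μ : ℝ) (χ : (ℤ → ℂ) →ₗ[ℂ] ℂ), 0 < l₀ → l₀ ≤ L → 0 ≤ μ →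
      (∀ ψ : ℤ → ℂ, ∑ n ∈ Finset.Ico m (m + l₀), d n * ‖ψ n‖ ^ 2 ≤
        ∑ n ∈ Finset.Ico m (m + l₀), ‖ψ (n + 1) - ψ n‖ ^ 2 + μ * ‖χ ψ‖ ^ 2) →
      (∀ ψ : ℤ → ℂ, ‖χ ψ‖ ^ 2 ≤ ∑ n ∈ Finset.Ico m (m + l₀), ‖ψ n‖ ^ 2) →
      Real.sqrt μ + 4 * (2 * ∑ n ∈ Finset.Ico (m + l₀) (m + l₀ + (L - l₀ : ℕ)), d n -
          if L - l₀ = 0 then 0 else d (m + l₀)) ≤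
        4 * (2 * ∑ n ∈ Finset.Ico m (m + L), d n - if L = 0 then 0 else d m) →
      ∃ (L' : ℕ) (l : List (ℝ × ((ℤ → ℂ) →ₗ[ℂ] ℂ))), L ≤ L' ∧ (∀ x ∈ l, 0 ≤ x.1) ∧
        (∀ ψ : ℤ → ℂ, ∑ n ∈ Finset.Ico m (m + L), d n * ‖ψ n‖ ^ 2 ≤
          ∑ n ∈ Finset.Ico m (m + L'), ‖ψ (n + 1) - ψ n‖ ^ 2 +
            (l.map fun x => x.1 * ‖x.2 ψ‖ ^ 2).sum) ∧
        (∀ ψ : ℤ → ℂ, (l.map fun x => ‖x.2 ψ‖ ^ 2).sum ≤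
          ∑ n ∈ Finset.Ico m (m + L'), ‖ψ n‖ ^ 2) ∧
        (l.map fun x => Real.sqrt x.1).sum ≤
          4 * (2 * ∑ n ∈ Finset.Ico m (m + L), d n - if L = 0 then 0 else d m) := by
    intro l₀ μ χ hl₀ hl₀L hμ h1 h2 h3
    obtain ⟨L', l, hL', hl, g1, g2, g3⟩ := ih (L - l₀) (by omega) (m + l₀)
    refine ⟨l₀ + L', (μ, χ) :: l, by omega, ?_, ?_, ?_, ?_⟩
    · intro x hx
      rcases List.mem_cons.1 hx with rfl | hx
      exacts [hμ, hl x hx]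
    · intro ψ
      rw [sum_Ico_add_cast m hl₀L, sum_Ico_add_cast m (Nat.le_add_right l₀ L'),
        Nat.add_sub_cancel_left, List.map_cons, List.sum_cons]
      linarith [h1 ψ, g1 ψ]
    · intro ψ
      rw [sum_Ico_add_cast m (Nat.le_add_right l₀ L'), Nat.add_sub_cancel_left, List.map_cons,
        List.sum_cons]
      linarith [h2 ψ, g2 ψ]
    · rw [List.map_cons, List.sum_cons]
      exact le_trans (by linarith) h3
  set s : ℕ → ℝ := fun l => ∑ n ∈ Finset.Ico m (m + l), d n with hs
  have hs0 : ∀ l, 0 ≤ s l := fun l => Finset.sum_nonneg fun n _ => hd n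
  have hdm : ∀ l, 0 < l → d m ≤ s l := fun l hl =>
    Finset.single_le_sum (f := d) (fun n _ => hd n) (by rw [Finset.mem_Ico]; omega)
  -- Here the whole remaining window is short enough to be the last block.
  by_cases hcase : 2 * s L * L ≤ 1
  · rcases (hs0 L).eq_or_lt with hzero | hpos
    · refine ⟨L, [], le_rfl, by simp, ?_, ?_, ?_⟩
      · intro ψ
        have hz : ∀ n ∈ Finset.Ico m (m + L), d n = 0 :=
          (Finset.sum_eq_zero_iff_of_nonneg fun n _ => hd n).1 hzero.symm
        rw [Finset.sum_eq_zero fun n hn => by rw [hz n hn, zero_mul]]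
        have : 0 ≤ ∑ n ∈ Finset.Ico m (m + L), ‖ψ (n + 1) - ψ n‖ ^ 2 :=
          Finset.sum_nonneg fun _ _ => by positivity
        simpa using this
      · intro ψ
        have : 0 ≤ ∑ n ∈ Finset.Ico m (m + L), ‖ψ n‖ ^ 2 :=
          Finset.sum_nonneg fun _ _ => by positivity
        simpa using this
      · have := hdm L hL
        have h0 := hd m
        rw [if_neg hL.ne']
        simp only [List.map_nil, List.sum_nil]
        change 0 ≤ 4 * (2 * s L - d m)
        linarith
    · have hL1 : (1 : ℝ) ≤ L := by exact_mod_cast hL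
      have hLle : (L : ℝ) ≤ 1 / (2 * s L) := by
        rw [le_div_iff₀ (by positivity)]; linarith
      -- The last block may be too short for `1 / L` to be paid by `s L`, so it is lengthened beyond
      -- the window as far as `2 s L' ≤ 1` allows; then `1 / L' ≤ 4 s`.
      set L' := ⌊1 / (2 * s L)⌋₊ with hL'
      have hLL' : L ≤ L' := Nat.le_floor hLle
      have hL'pos : 0 < L' := by omega
      have hL'r : (0 : ℝ) < L' := by exact_mod_cast hL'pos
      have hle : (L' : ℝ) ≤ 1 / (2 * s L) := Nat.floor_le (by positivity)
      have hlt : 1 / (2 * s L) < L' + 1 := Nat.lt_floor_add_one _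
      have hL'1 : (1 : ℝ) ≤ L' := by exact_mod_cast hL'pos
      have hsL' : 2 * s L * L' ≤ 1 := by
        rw [le_div_iff₀ (by positivity)] at hle; linarith
      refine ⟨L', [(2 * s L / L', blockMean m L')], hLL', ?_, ?_, ?_, ?_⟩
      · intro x hx
        rw [List.mem_singleton] at hx
        subst hx
        exact div_nonneg (by linarith) hL'r.le
      · intro ψ
        simpa using sum_mul_norm_sq_le_blockMean hd ψ m hLL' hsL'
      · intro ψ
        simpa using norm_blockMean_sq_le m L' ψ
      · simp only [List.map_cons, List.map_nil, List.sum_cons, List.sum_nil, add_zero]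
        have h1 : Real.sqrt (2 * s L / L') ≤ 1 / L' := sqrt_two_mul_div_le hL'pos hsL'
        have h2 : 1 / (L' : ℝ) ≤ 4 * s L := by
          rw [div_lt_iff₀ (by positivity)] at hlt
          rw [div_le_iff₀ hL'r]
          nlinarith
        have := hdm L hL
        rw [if_neg hL.ne']
        change _ ≤ 4 * (2 * s L - d m)
        linarith
  · have hex : ∃ l : ℕ, 1 < 2 * s l * l := ⟨L, not_le.1 hcase⟩
    classical
    set l := Nat.find hex with hl
    have hlspec : 1 < 2 * s l * l := Nat.find_spec hex
    have hlL : l ≤ L := Nat.find_le (not_le.1 hcase)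
    have hl0 : l ≠ 0 := by
      intro h
      rw [h] at hlspec
      norm_num at hlspec
    -- If one site already fails the condition, then `d m > 1/2`. That site forms its own block with
    -- evaluation as functional, and `√(d m) ≤ 4 d m`.
    by_cases hl1 : l = 1
    · have hs1 : s 1 = d m := by
        have : Finset.Ico m (m + ((1 : ℕ) : ℤ)) = {m} := by
          ext x
          simp only [Finset.mem_Ico, Finset.mem_singleton]
          omega
        simp only [hs, this, Finset.sum_singleton]
      have hIco : Finset.Ico m (m + ((1 : ℕ) : ℤ)) = {m} := by
        ext x
        simp only [Finset.mem_Ico, Finset.mem_singleton]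
        omega
      rw [hl1, hs1] at hlspec
      norm_num at hlspec
      refine hglue 1 (d m) (LinearMap.proj m) one_pos hL (hd m) ?_ ?_ ?_
      · intro ψ
        rw [hIco, Finset.sum_singleton, Finset.sum_singleton, LinearMap.proj_apply]
        have : 0 ≤ ‖ψ (m + 1) - ψ m‖ ^ 2 := by positivity
        linarith
      · intro ψ
        rw [hIco, Finset.sum_singleton, LinearMap.proj_apply]
      · rw [sum_Ico_add_cast m hL, hIco, Finset.sum_singleton, if_neg hL.ne']
        have h1 : Real.sqrt (d m) ≤ 4 * d m := by
          refine Real.sqrt_le_iff.2 ⟨by linarith, ?_⟩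
          nlinarith
        have h2 : 0 ≤ if L - 1 = 0 then 0 else d (m + ((1 : ℕ) : ℤ)) := by
          split_ifs
          exacts [le_rfl, hd _]
        linarith
    · obtain ⟨l₀, hl₀⟩ : ∃ l₀, l = l₀ + 1 := ⟨l - 1, by omega⟩
      have hl₀pos : 0 < l₀ := by omega
      have hl₀r : (1 : ℝ) ≤ l₀ := by exact_mod_cast hl₀pos
      have hmin : 2 * s l₀ * l₀ ≤ 1 := not_lt.1 (Nat.find_min hex (by omega : l₀ < l))
      refine hglue l₀ (2 * s l₀ / l₀) (blockMean m l₀) hl₀pos (by omega)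
        (div_nonneg (by linarith [hs0 l₀]) (by positivity)) ?_ ?_ ?_
      · intro ψ
        exact sum_mul_norm_sq_le_blockMean hd ψ m le_rfl hmin
      · exact norm_blockMean_sq_le m l₀
      · have hsl : s l = s l₀ + d (m + l₀) := by
          simp only [hs]
          rw [sum_Ico_add_cast m (by omega : l₀ ≤ l)]
          congr 1
          have : l - l₀ = 1 := by omega
          rw [this]
          have hIco : Finset.Ico (m + (l₀ : ℤ)) (m + l₀ + ((1 : ℕ) : ℤ)) = {m + (l₀ : ℤ)} := by
            ext x
            simp only [Finset.mem_Ico, Finset.mem_singleton]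
            omega
          rw [hIco, Finset.sum_singleton]
        rw [sum_Ico_add_cast m (by omega : l₀ ≤ L), if_neg hL.ne', if_neg (by omega)]
        have h1 : Real.sqrt (2 * s l₀ / l₀) ≤ 1 / l₀ := sqrt_two_mul_div_le hl₀pos hmin
        -- The length `l₀ + 1` violates the condition and is at most `2 l₀`, so `1 < 2 s l · l ≤ 4 s
        -- l · l₀`.
        have h2 : 1 / (l₀ : ℝ) ≤ 4 * s l := by
          rw [div_le_iff₀ (by positivity)]
          rw [hl₀] at hlspec ⊢
          push_cast at hlspec
          nlinarith [hs0 (l₀ + 1)]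
        have h3 := hdm l₀ hl₀pos
        change Real.sqrt (2 * s l₀ / l₀) + _ ≤ 4 * (2 * (s l₀ + _) - d m)
        linarith

/-! ### Quadratic form bounds on spectral subspaces -/

section Spectral

variable {H : Type*} [NormedAddCommGroup H] [InnerProductSpace ℂ H] [CompleteSpace H]

theorem mem_spectralRangeIci {A : H →L[ℂ] H} {c : ℝ} {φ : H} :
    φ ∈ spectralRangeIci A c ↔ cfc (fun x : ℝ => max (c - x) 0) A φ = 0 := Iff.rfl

theorem isClosed_spectralRangeIci (A : H →L[ℂ] H) (c : ℝ) :
    IsClosed (spectralRangeIci A c : Set H) :=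
  ContinuousLinearMap.isClosed_ker (cfc (fun x : ℝ => max (c - x) 0) A : H →L[ℂ] H)

instance (A : H →L[ℂ] H) (c : ℝ) : CompleteSpace (spectralRangeIci A c) :=
  (isClosed_spectralRangeIci A c).completeSpace_coe

theorem re_inner_cfc_nonneg (A : H →L[ℂ] H) {f : ℝ → ℝ} (hf : ∀ x ∈ spectrum ℝ A, 0 ≤ f x)
    (φ : H) : 0 ≤ (inner ℂ φ (cfc f A φ)).re := by
  have h : 0 ≤ cfc f A := cfc_nonneg hf
  exact ((ContinuousLinearMap.nonneg_iff_isPositive _).1 h).re_inner_nonneg_right φ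

theorem cfc_sub_const_apply {A : H →L[ℂ] H} (hA : IsSelfAdjoint A) (c : ℝ) (φ : H) :
    cfc (fun x : ℝ => x - c) A φ = A φ - (c : ℂ) • φ := by
  rw [cfc_sub (R := ℝ) (fun x => x) (fun _ => c) A, cfc_id' ℝ A, cfc_const c A]
  simp [Algebra.algebraMap_eq_smul_one]

/-- On the kernel of the negative part, `A - c` acts as its positive part. -/
theorem le_re_inner_of_mem_spectralRangeIci {A : H →L[ℂ] H} (hA : IsSelfAdjoint A) {c : ℝ} {φ : H}
    (hφ : φ ∈ spectralRangeIci A c) : c * ‖φ‖ ^ 2 ≤ (inner ℂ φ (A φ)).re := by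
  rw [mem_spectralRangeIci] at hφ
  have h1 : cfc (fun x : ℝ => x - c) A φ = cfc (fun x : ℝ => max (x - c) 0) A φ := by
    have : (fun x : ℝ => x - c) = fun x => max (x - c) 0 - max (c - x) 0 := by
      funext x
      rcases le_total x c with h | h
      · rw [max_eq_right (by linarith), max_eq_left (by linarith)]; ring
      · rw [max_eq_left (by linarith), max_eq_right (by linarith)]; ring
    rw [this, cfc_sub (R := ℝ) (fun x => max (x - c) 0) (fun x => max (c - x) 0) A,
      sub_apply, hφ, sub_zero]
  have h2 := re_inner_cfc_nonneg A (f := fun x => max (x - c) 0) (fun x _ => le_max_right _ _) φ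
  rw [← h1, cfc_sub_const_apply hA, inner_sub_right, inner_smul_right, inner_self_eq_norm_sq_to_K,
    Complex.sub_re] at h2
  have h3 : ((c : ℂ) * ((‖φ‖ : ℝ) : ℂ) ^ 2).re = c * ‖φ‖ ^ 2 := by
    rw [← Complex.ofReal_pow, ← Complex.ofReal_mul, Complex.ofReal_re]
  have h4 : ((c : ℂ) * (RCLike.ofReal ‖φ‖ : ℂ) ^ 2).re = c * ‖φ‖ ^ 2 := h3
  linarith

/-- For `c < d`, `max (c - x) 0` is a continuous multiple of `max (d - x) 0`, so its operator
vanishes wherever the latter's does. -/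
theorem spectralRangeIci_antitone (A : H →L[ℂ] H) : Antitone (spectralRangeIci A) := by
  intro c d hcd φ hφ
  rcases hcd.eq_or_lt with rfl | hcd
  · exact hφ
  rw [mem_spectralRangeIci] at hφ ⊢
  have hpos : ∀ x : ℝ, max (c - x) 0 + (d - c) ≠ 0 := fun x => by
    have := le_max_right (c - x) 0
    linarith
  have hcont : Continuous fun x : ℝ => max (c - x) 0 / (max (c - x) 0 + (d - c)) := by
    refine Continuous.div (by fun_prop) (by fun_prop) hpos
  have : (fun x : ℝ => max (c - x) 0) =
      fun x => max (c - x) 0 / (max (c - x) 0 + (d - c)) * max (d - x) 0 := by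
    funext x
    rcases le_total x c with h | h
    · rw [max_eq_left (by linarith : (0 : ℝ) ≤ c - x), max_eq_left (by linarith : (0 : ℝ) ≤ d - x)]
      have : c - x + (d - c) = d - x := by ring
      rw [this, div_mul_cancel₀]
      linarith
    · rw [max_eq_right (by linarith : c - x ≤ (0 : ℝ))]
      simp
  rw [this, cfc_mul (R := ℝ) (fun x => max (c - x) 0 / (max (c - x) 0 + (d - c)))
    (fun x => max (d - x) 0) A hcont.continuousOn (by fun_prop), mul_apply_eq_comp, hφ,
    map_zero]

theorem map_mem_spectralRangeIci {A : H →L[ℂ] H} {c : ℝ} {φ : H}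
    (hφ : φ ∈ spectralRangeIci A c) : A φ ∈ spectralRangeIci A c := by
  rw [mem_spectralRangeIci] at hφ ⊢
  by_cases hA : IsSelfAdjoint A
  · have hcomm : Commute (cfc (fun x : ℝ => max (c - x) 0) A) A := by
      have := cfc_commute_cfc (fun x : ℝ => max (c - x) 0) (fun x => x) A
      rwa [cfc_id' ℝ A] at this
    have := congrArg (fun T : H →L[ℂ] H => T φ) hcomm.eq
    simp only [mul_apply_eq_comp, hφ, map_zero] at this
    exact this
  · rw [cfc_apply_of_not_predicate A hA]
    rfl

theorem map_mem_orthogonal_spectralRangeIci {A : H →L[ℂ] H} (hA : IsSelfAdjoint A) {c : ℝ} {φ : H}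
    (hφ : φ ∈ (spectralRangeIci A c)ᗮ) : A φ ∈ (spectralRangeIci A c)ᗮ := by
  rw [Submodule.mem_orthogonal] at hφ ⊢
  intro ψ hψ
  have := hA.isSymmetric ψ φ
  simp only [ContinuousLinearMap.coe_coe] at this
  rw [← this]
  exact hφ _ (map_mem_spectralRangeIci hψ)

theorem map_mem_spectralRangeIco {A : H →L[ℂ] H} (hA : IsSelfAdjoint A) {c d : ℝ} {φ : H}
    (hφ : φ ∈ spectralRangeIco A c d) : A φ ∈ spectralRangeIco A c d :=
  ⟨map_mem_spectralRangeIci hφ.1, map_mem_orthogonal_spectralRangeIci hA hφ.2⟩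

/-- The orthogonal complement of the kernel of `G = (A - c)₋` is the closure of the range of `G`. On
that range the bound says `G (A - a) G ≤ 0`, which holds because the spectrum below `c` lies below
`a`. -/
theorem re_inner_le_of_mem_orthogonal_spectralRangeIci {A : H →L[ℂ] H} (hA : IsSelfAdjoint A)
    {a c : ℝ} (hgap : ∀ x ∈ spectrum ℝ A, x < c → x ≤ a) {φ : H}
    (hφ : φ ∈ (spectralRangeIci A c)ᗮ) : (inner ℂ φ (A φ)).re ≤ a * ‖φ‖ ^ 2 := by
  set G : H →L[ℂ] H := cfc (fun x : ℝ => max (c - x) 0) A with hG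
  have hGsa : IsSelfAdjoint G := cfc_predicate _ _
  have hrange : ∀ ψ, (inner ℂ (G ψ) (A (G ψ))).re ≤ a * ‖G ψ‖ ^ 2 := by
    intro ψ
    have h1 := re_inner_cfc_nonneg A
      (f := fun x => -(max (c - x) 0 * ((x - a) * max (c - x) 0))) (fun x hx => ?_) ψ
    · rw [cfc_neg (fun x => max (c - x) 0 * ((x - a) * max (c - x) 0)) A,
        cfc_mul (R := ℝ) (fun x => max (c - x) 0) (fun x => (x - a) * max (c - x) 0) A,
        cfc_mul (R := ℝ) (fun x => x - a) (fun x => max (c - x) 0) A, ← hG, neg_apply,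
        mul_apply_eq_comp, mul_apply_eq_comp, cfc_sub_const_apply hA] at h1
      have h2 := hGsa.isSymmetric ψ (A (G ψ) - (a : ℂ) • G ψ)
      simp only [ContinuousLinearMap.coe_coe] at h2
      rw [inner_neg_right, ← h2, inner_sub_right, inner_smul_right,
        inner_self_eq_norm_sq_to_K, Complex.neg_re, Complex.sub_re] at h1
      have h3 : ((a : ℂ) * (RCLike.ofReal ‖G ψ‖ : ℂ) ^ 2).re = a * ‖G ψ‖ ^ 2 := by
        change ((a : ℂ) * ((‖G ψ‖ : ℝ) : ℂ) ^ 2).re = a * ‖G ψ‖ ^ 2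
        rw [← Complex.ofReal_pow, ← Complex.ofReal_mul, Complex.ofReal_re]
      linarith
    · rcases lt_or_ge x c with h | h
      · have := hgap x hx h
        have h0 := le_max_right (c - x) 0
        have : 0 ≤ (a - x) * (max (c - x) 0 * max (c - x) 0) := by
          apply mul_nonneg <;> nlinarith
        linarith
      · rw [max_eq_right (by linarith : c - x ≤ (0 : ℝ))]
        simp
  have hclosure : φ ∈ closure (Set.range G) := by
    have h1 : spectralRangeIci A c = LinearMap.ker G.toLinearMap := rfl
    rw [h1, ContinuousLinearMap.orthogonal_ker, ContinuousLinearMap.isSelfAdjoint_iff'.1 hGsa]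
      at hφ
    exact hφ
  have hcl : IsClosed {ψ : H | (inner ℂ ψ (A ψ)).re ≤ a * ‖ψ‖ ^ 2} :=
    isClosed_le (by fun_prop) (by fun_prop)
  refine hcl.closure_subset_iff.2 ?_ hclosure
  rintro _ ⟨ψ, rfl⟩
  exact hrange ψ

end Spectral

/-! ### Jacobi matrices as quadratic forms -/

theorem ellTwo_summable_norm_sq (φ : EllTwo) : Summable fun n => ‖φ n‖ ^ 2 := by
  have h := (lp.memℓp φ).summable (by norm_num)
  simpa using h

theorem ellTwo_norm_apply_le (φ : EllTwo) (n : ℤ) : ‖φ n‖ ≤ ‖φ‖ :=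
  lp.norm_apply_le_norm (by norm_num) φ n

theorem BddSeq.exists_nonneg {d : ℤ → ℝ} (hd : BddSeq d) : ∃ M : ℝ, 0 ≤ M ∧ ∀ n, |d n| ≤ M := by
  obtain ⟨M, hM⟩ := hd
  exact ⟨M, (abs_nonneg _).trans (hM 0), hM⟩

theorem inner_ellTwo (φ ψ : EllTwo) : inner ℂ φ ψ = ∑' n, inner ℂ (φ n) (ψ n) := rfl

theorem jacobiOp_isSelfAdjoint (a b : ℤ → ℝ) (ha : BddSeq a) (hb : BddSeq b) :
    IsSelfAdjoint (jacobiOp a b ha hb) := by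
  rw [ContinuousLinearMap.isSelfAdjoint_iff_isSymmetric]
  have hdiag : ∀ (d : ℤ → ℝ) (hd : BddSeq d) (φ ψ : EllTwo),
      inner ℂ (diagOp d hd φ) ψ = inner ℂ φ (diagOp d hd ψ) := by
    intro d hd φ ψ
    rw [inner_ellTwo, inner_ellTwo]
    refine tsum_congr fun n => ?_
    change inner ℂ ((d n : ℂ) * φ n) (ψ n) = inner ℂ (φ n) ((d n : ℂ) * ψ n)
    simp only [RCLike.inner_apply, map_mul, Complex.conj_ofReal]
    ring
  have htrans : ∀ (s : ℤ) (φ ψ : EllTwo),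
      inner ℂ (translateOp s φ) ψ = inner ℂ φ (translateOp (-s) ψ) := by
    intro s φ ψ
    rw [inner_ellTwo, inner_ellTwo,
      ← (Equiv.addRight s).tsum_eq fun n => inner ℂ (φ n) (translateOp (-s) ψ n)]
    refine tsum_congr fun n => ?_
    change inner ℂ (φ (n + s)) (ψ n) = inner ℂ (φ (n + s)) (ψ (n + s + -s))
    rw [add_neg_cancel_right]
  intro φ ψ
  have h1 := htrans 1 φ (diagOp a ha ψ)
  have h2 := htrans (-1) (diagOp a ha φ) ψ
  simp only [jacobiOp, ContinuousLinearMap.coe_coe, add_apply,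
    ContinuousLinearMap.comp_apply, inner_add_left, inner_add_right, hdiag, h1, h2, neg_neg]
  ring

/-- Each off-diagonal product is split by `2xy ≤ x² + y²`, so the perturbation is dominated by a
diagonal potential. -/
theorem re_inner_jacobiOp_le (a b : ℤ → ℝ) (ha : BddSeq a) (hb : BddSeq b) (φ : EllTwo) :
    |(inner ℂ φ (jacobiOp a b ha hb φ)).re| ≤
      ∑' n, (|b n| + |a n| + |a (n - 1)|) * ‖φ n‖ ^ 2 := by
  obtain ⟨Ma, hMa0, hMa⟩ := ha.exists_nonneg
  obtain ⟨Mb, hMb0, hMb⟩ := hb.exists_nonneg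
  have hφ := ellTwo_summable_norm_sq φ
  have hsum : ∀ (w : ℤ → ℝ) (M : ℝ), (∀ n, |w n| ≤ M) →
      Summable fun n => |w n| * ‖φ n‖ ^ 2 := fun w M hw =>
    Summable.of_nonneg_of_le (fun n => by positivity)
      (fun n => mul_le_mul_of_nonneg_right (hw n) (by positivity)) (hφ.mul_left M)
  have hA := hsum a Ma hMa
  have hA' := hsum (fun n => a (n - 1)) Ma fun n => hMa _
  have hB := hsum b Mb hMb
  have hs1 : Summable fun n => |a (n - 1)| * ‖φ (n - 1)‖ ^ 2 :=
    (Equiv.subRight (1 : ℤ)).summable_iff.mpr hA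
  have hs2 : Summable fun n => |a n| * ‖φ (n + 1)‖ ^ 2 := by
    have := (Equiv.addRight (1 : ℤ)).summable_iff.mpr hA'
    refine this.congr fun n => ?_
    simp
  have ht1 : ∑' n, |a (n - 1)| * ‖φ (n - 1)‖ ^ 2 = ∑' n, |a n| * ‖φ n‖ ^ 2 :=
    (Equiv.subRight (1 : ℤ)).tsum_eq fun n => |a n| * ‖φ n‖ ^ 2
  have ht2 : ∑' n, |a n| * ‖φ (n + 1)‖ ^ 2 = ∑' n, |a (n - 1)| * ‖φ n‖ ^ 2 := by
    rw [← (Equiv.addRight (1 : ℤ)).tsum_eq fun n => |a (n - 1)| * ‖φ n‖ ^ 2]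
    refine tsum_congr fun n => ?_
    simp
  have hterm : ∀ n, ‖inner ℂ (φ n) (jacobiOp a b ha hb φ n)‖ ≤
      (1 / 2) * (|a n| * ‖φ n‖ ^ 2 + |a n| * ‖φ (n + 1)‖ ^ 2) + |b n| * ‖φ n‖ ^ 2 +
      (1 / 2) * (|a (n - 1)| * ‖φ n‖ ^ 2 + |a (n - 1)| * ‖φ (n - 1)‖ ^ 2) := by
    intro n
    have key : ∀ x y w : ℝ, 0 ≤ w → x * (w * y) ≤ (1 / 2) * (w * x ^ 2 + w * y ^ 2) := by
      intro x y w hw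
      nlinarith [mul_nonneg hw (sq_nonneg (x - y))]
    calc ‖inner ℂ (φ n) (jacobiOp a b ha hb φ n)‖ ≤ ‖φ n‖ * ‖jacobiOp a b ha hb φ n‖ :=
          norm_inner_le_norm _ _
      _ ≤ ‖φ n‖ * (|a n| * ‖φ (n + 1)‖ + |b n| * ‖φ n‖ + |a (n - 1)| * ‖φ (n - 1)‖) := by
          gcongr
          rw [jacobiOp_apply]
          refine (norm_add₃_le).trans (le_of_eq ?_)
          simp only [norm_mul, Complex.norm_real, Real.norm_eq_abs]
      _ = ‖φ n‖ * (|a n| * ‖φ (n + 1)‖) + |b n| * ‖φ n‖ ^ 2 +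
            ‖φ n‖ * (|a (n - 1)| * ‖φ (n - 1)‖) := by ring
      _ ≤ _ := by
          have h1 := key ‖φ n‖ ‖φ (n + 1)‖ |a n| (abs_nonneg _)
          have h2 := key ‖φ n‖ ‖φ (n - 1)‖ |a (n - 1)| (abs_nonneg _)
          linarith
  have hR1 := (hA.add hs2).mul_left (1 / 2)
  have hR2 := (hA'.add hs1).mul_left (1 / 2)
  have hR := (hR1.add hB).add hR2
  calc |(inner ℂ φ (jacobiOp a b ha hb φ)).re| ≤ ‖inner ℂ φ (jacobiOp a b ha hb φ)‖ :=
        Complex.abs_re_le_norm _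
    _ ≤ _ := tsum_of_norm_bounded hR.hasSum hterm
    _ = _ := by
      have e : ∀ n, (|b n| + |a n| + |a (n - 1)|) * ‖φ n‖ ^ 2 =
          |b n| * ‖φ n‖ ^ 2 + |a n| * ‖φ n‖ ^ 2 + |a (n - 1)| * ‖φ n‖ ^ 2 := fun n => by ring
      simp_rw [e]
      rw [(hR1.add hB).tsum_add hR2, hR1.tsum_add hB, tsum_mul_left, tsum_mul_left,
        hA.tsum_add hs2, hA'.tsum_add hs1, ht1, ht2, (hB.add hA).tsum_add hA', hB.tsum_add hA]
      ring

/-! ### Bessel's inequality for exponentials of the phase -/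

theorem integral_exp_int_mul_I (j : ℤ) :
    ∫ x in (-Real.pi)..Real.pi, Complex.exp (Complex.I * x * j) =
      if j = 0 then 2 * (Real.pi : ℂ) else 0 := by
  split_ifs with hj
  · simp [hj]
    ring
  · have hc : Complex.I * (j : ℂ) ≠ 0 := mul_ne_zero Complex.I_ne_zero (by exact_mod_cast hj)
    have h := integral_exp_mul_complex (a := -Real.pi) (b := Real.pi) hc
    have e : ∀ x : ℝ, Complex.I * x * j = Complex.I * j * x := fun x => by ring
    simp_rw [e]
    rw [h, div_eq_zero_iff]
    left
    have h1 : Complex.I * (j : ℂ) * ((Real.pi : ℝ) : ℂ) =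
        Complex.I * j * ((-Real.pi : ℝ) : ℂ) + j * (2 * Real.pi * Complex.I) := by
      push_cast; ring
    rw [h1, Complex.exp_periodic.int_mul j, sub_self]

theorem integral_norm_sq_sum_exp (S : Finset ℤ) (c : ℤ → ℂ) :
    ∫ x in (-Real.pi)..Real.pi, ‖∑ n ∈ S, c n * Complex.exp (Complex.I * x * n)‖ ^ 2 =
      2 * Real.pi * ∑ n ∈ S, ‖c n‖ ^ 2 := by
  have hpt : ∀ x : ℝ, ((‖∑ n ∈ S, c n * Complex.exp (Complex.I * x * n)‖ ^ 2 : ℝ) : ℂ) =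
      ∑ n ∈ S, ∑ m ∈ S, c n * star (c m) * Complex.exp (Complex.I * x * (n - m : ℤ)) := by
    intro x
    rw [Complex.ofReal_pow, ← Complex.mul_conj', map_sum, Finset.sum_mul_sum]
    refine Finset.sum_congr rfl fun n _ => Finset.sum_congr rfl fun m _ => ?_
    rw [map_mul, ← Complex.exp_conj, map_mul, map_mul, Complex.conj_I, Complex.conj_ofReal,
      map_intCast]
    have : Complex.exp (Complex.I * x * (n - m : ℤ)) =
        Complex.exp (Complex.I * x * n) * Complex.exp (-Complex.I * x * m) := by
      rw [← Complex.exp_add]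
      congr 1
      push_cast
      ring
    rw [this]
    simp only [Complex.star_def]
    ring
  have hcast : ((∫ x in (-Real.pi)..Real.pi,
      ‖∑ n ∈ S, c n * Complex.exp (Complex.I * x * n)‖ ^ 2 : ℝ) : ℂ) =
      ((2 * Real.pi * ∑ n ∈ S, ‖c n‖ ^ 2 : ℝ) : ℂ) := by
    rw [← intervalIntegral.integral_ofReal]
    simp_rw [hpt]
    have hint : ∀ n m : ℤ, IntervalIntegrable (fun x : ℝ => c n * star (c m) *
        Complex.exp (Complex.I * x * (n - m : ℤ))) volume (-Real.pi) Real.pi := fun n m =>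
      Continuous.intervalIntegrable (by fun_prop) _ _
    rw [intervalIntegral.integral_finsetSum fun n _ =>
      Continuous.intervalIntegrable (by fun_prop) _ _]
    simp_rw [intervalIntegral.integral_finsetSum fun m _ => hint _ m,
      intervalIntegral.integral_const_mul, integral_exp_int_mul_I, sub_eq_zero]
    simp only [mul_ite, mul_zero, Finset.sum_ite_eq]
    push_cast
    rw [Finset.mul_sum]
    refine Finset.sum_congr rfl fun n hn => ?_
    rw [if_pos hn, ← Complex.mul_conj']
    simp only [Complex.star_def]
    ring
  exact_mod_cast hcast

/-- Substitute `x = θ k`: the Jacobian is at least `c`, and `θ` is injective into a single period,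
where Parseval applies. -/
theorem integral_norm_sq_sum_exp_comp_le {θ θ' : ℝ → ℝ} {r c : ℝ} (hc : 0 < c)
    (hθ : ∀ k ∈ Ioo (-r) r, HasDerivAt θ (θ' k) k) (hθ' : ∀ k ∈ Ioo (-r) r, c ≤ θ' k)
    (hmaps : MapsTo θ (Ioo (-r) r) (Ioc (-Real.pi) Real.pi)) (S : Finset ℤ) (a : ℤ → ℂ) :
    ∫ k in Ioo (-r) r, ‖∑ n ∈ S, a n * Complex.exp (Complex.I * θ k * n)‖ ^ 2 ≤
      2 * Real.pi / c * ∑ n ∈ S, ‖a n‖ ^ 2 := by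
  set g : ℝ → ℝ := fun x => ‖∑ n ∈ S, a n * Complex.exp (Complex.I * x * n)‖ ^ 2 with hg
  have hgc : Continuous g := by fun_prop
  have hg0 : ∀ x, 0 ≤ g x := fun x => by positivity
  have hinj : InjOn θ (Ioo (-r) r) := by
    refine (strictMonoOn_of_deriv_pos (convex_Ioo _ _)
      (fun k hk => (hθ k hk).continuousAt.continuousWithinAt) fun k hk => ?_).injOn
    rw [interior_Ioo] at hk
    rw [(hθ k hk).deriv]
    exact hc.trans_le (hθ' k hk)
  have hgint : IntegrableOn g (Ioc (-Real.pi) Real.pi) :=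
    (hgc.intervalIntegrable _ _).1
  have himg : IntegrableOn g (θ '' Ioo (-r) r) := hgint.mono_set hmaps.image_subset
  have hcomp : IntegrableOn (fun k => |θ' k| • g (θ k)) (Ioo (-r) r) :=
    (integrableOn_image_iff_integrableOn_abs_deriv_smul measurableSet_Ioo
      (fun k hk => (hθ k hk).hasDerivWithinAt) hinj g).1 himg
  have hpi : (-Real.pi) ≤ Real.pi := by linarith [Real.pi_pos]
  calc ∫ k in Ioo (-r) r, g (θ k) ≤ ∫ k in Ioo (-r) r, c⁻¹ * (|θ' k| • g (θ k)) := by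
        refine integral_mono_of_nonneg (Filter.Eventually.of_forall fun k => hg0 _)
          (hcomp.const_mul _) ?_
        refine (ae_restrict_iff' measurableSet_Ioo).2 (Filter.Eventually.of_forall fun k hk => ?_)
        have h1 := hθ' k hk
        change g (θ k) ≤ c⁻¹ * (|θ' k| * g (θ k))
        rw [← div_eq_inv_mul, le_div_iff₀ hc, mul_comm]
        exact mul_le_mul_of_nonneg_right (h1.trans (le_abs_self _)) (hg0 _)
    _ = c⁻¹ * ∫ x in θ '' Ioo (-r) r, g x := by
        rw [integral_const_mul, integral_image_eq_integral_abs_deriv_smul measurableSet_Ioo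
          (fun k hk => (hθ k hk).hasDerivWithinAt) hinj g]
    _ ≤ c⁻¹ * ∫ x in Ioc (-Real.pi) Real.pi, g x := by
        refine mul_le_mul_of_nonneg_left ?_ (inv_nonneg.2 hc.le)
        exact setIntegral_mono_set hgint (Filter.Eventually.of_forall hg0)
          hmaps.image_subset.eventuallyLE
    _ = 2 * Real.pi / c * ∑ n ∈ S, ‖a n‖ ^ 2 := by
        rw [← intervalIntegral.integral_of_le hpi, integral_norm_sq_sum_exp]
        ring

theorem norm_exp_I_mul_ofReal_mul_int (x : ℝ) (n : ℤ) :
    ‖Complex.exp (Complex.I * x * n)‖ = 1 := by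
  have : Complex.I * x * n = ((x * n : ℝ) : ℂ) * Complex.I := by push_cast; ring
  rw [this, Complex.norm_exp_ofReal_mul_I]

/-- Bessel's inequality for the functions `exp (i n θ)` on an interval on which `θ` is a
diffeomorphism into an interval of length `2π`. -/
theorem sum_norm_integral_mul_exp_sq_le {θ θ' : ℝ → ℝ} {r c : ℝ} (hc : 0 < c)
    (hθ : ∀ k ∈ Ioo (-r) r, HasDerivAt θ (θ' k) k) (hθ' : ∀ k ∈ Ioo (-r) r, c ≤ θ' k)
    (hmaps : MapsTo θ (Ioo (-r) r) (Ioc (-Real.pi) Real.pi)) {F : ℝ → ℂ}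
    (hF : MemLp F 2 (volume.restrict (Ioo (-r) r))) (S : Finset ℤ) :
    ∑ n ∈ S, ‖∫ k in Ioo (-r) r, F k * Complex.exp (Complex.I * θ k * n)‖ ^ 2 ≤
      2 * Real.pi / c * ∫ k in Ioo (-r) r, ‖F k‖ ^ 2 := by
  set ψ : ℤ → ℂ := fun n => ∫ k in Ioo (-r) r, F k * Complex.exp (Complex.I * θ k * n) with hψ
  set X := ∑ n ∈ S, ‖ψ n‖ ^ 2 with hX
  set lam := 2 * Real.pi / c with hlam
  have hlam0 : 0 < lam := by positivity
  have hθc : ContinuousOn θ (Ioo (-r) r) := fun k hk => (hθ k hk).continuousAt.continuousWithinAt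
  have hexp : ∀ n : ℤ, AEStronglyMeasurable (fun k => Complex.exp (Complex.I * θ k * n))
      (volume.restrict (Ioo (-r) r)) := fun n =>
    ContinuousOn.aestronglyMeasurable (by fun_prop) measurableSet_Ioo
  have hexpn : ∀ (n : ℤ) (k : ℝ), ‖Complex.exp (Complex.I * θ k * n)‖ = 1 := fun n k =>
    norm_exp_I_mul_ofReal_mul_int (θ k) n
  have hFi : Integrable F (volume.restrict (Ioo (-r) r)) := hF.integrable (by norm_num)
  have hFe : ∀ n : ℤ, Integrable (fun k => F k * Complex.exp (Complex.I * θ k * n))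
      (volume.restrict (Ioo (-r) r)) := fun n =>
    hFi.mul_bdd (c := 1) (hexp n) (Filter.Eventually.of_forall fun k => (hexpn n k).le)
  -- Duality: the left side `X` equals `∫ F G`, and the previous bound gives `∫ |G|² ≤ lam * X`. The
  -- weights `lam`, `lam⁻¹` in the arithmetic-geometric mean inequality let half of `X` be absorbed.
  set G : ℝ → ℂ := fun k => ∑ n ∈ S, star (ψ n) * Complex.exp (Complex.I * θ k * n) with hG
  have hGm : AEStronglyMeasurable G (volume.restrict (Ioo (-r) r)) := by
    refine Finset.aestronglyMeasurable_fun_sum S fun n _ => ?_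
    exact (hexp n).const_mul _
  have hGb : ∀ k, ‖G k‖ ≤ ∑ n ∈ S, ‖ψ n‖ := by
    intro k
    refine (norm_sum_le _ _).trans (le_of_eq (Finset.sum_congr rfl fun n _ => ?_))
    rw [norm_mul, hexpn, mul_one, norm_star]
  have hG2 : Integrable (fun k => ‖G k‖ ^ 2) (volume.restrict (Ioo (-r) r)) := by
    refine Integrable.of_bound (C := (∑ n ∈ S, ‖ψ n‖) ^ 2) (hGm.norm.pow 2)
      (Filter.Eventually.of_forall fun k => ?_)
    rw [Real.norm_of_nonneg (by positivity)]
    gcongr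
    exact hGb k
  have hF2 : Integrable (fun k => ‖F k‖ ^ 2) (volume.restrict (Ioo (-r) r)) :=
    (memLp_two_iff_integrable_sq_norm hF.1).1 hF
  have hXc : (X : ℂ) = ∫ k in Ioo (-r) r, F k * G k := by
    have : ∀ k, F k * G k =
        ∑ n ∈ S, star (ψ n) * (F k * Complex.exp (Complex.I * θ k * n)) := by
      intro k
      simp only [hG, Finset.mul_sum]
      exact Finset.sum_congr rfl fun n _ => by ring
    simp_rw [this]
    rw [integral_finsetSum _ fun n _ => (hFe n).const_mul _]
    simp_rw [integral_const_mul]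
    rw [hX]
    push_cast
    refine Finset.sum_congr rfl fun n _ => ?_
    change _ = star (ψ n) * ψ n
    rw [← Complex.conj_mul']
    rfl
  have hX0 : 0 ≤ X := Finset.sum_nonneg fun _ _ => by positivity
  have h1 : X ≤ ∫ k in Ioo (-r) r, (1 / 2) * (lam * ‖F k‖ ^ 2 + lam⁻¹ * ‖G k‖ ^ 2) := by
    have : X = ‖(X : ℂ)‖ := by rw [Complex.norm_real, Real.norm_of_nonneg hX0]
    rw [this, hXc]
    refine norm_integral_le_of_norm_le (((hF2.const_mul _).add (hG2.const_mul _)).const_mul _)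
      (Filter.Eventually.of_forall fun k => ?_)
    rw [norm_mul]
    have h2 := sq_nonneg (lam * ‖F k‖ - ‖G k‖)
    have h3 : lam * ‖F k‖ ^ 2 + lam⁻¹ * ‖G k‖ ^ 2 - 2 * (‖F k‖ * ‖G k‖) =
        lam⁻¹ * (lam * ‖F k‖ - ‖G k‖) ^ 2 := by
      field_simp
      ring
    have h4 : 0 ≤ lam⁻¹ * (lam * ‖F k‖ - ‖G k‖) ^ 2 := by positivity
    linarith
  have h2 : ∫ k in Ioo (-r) r, ‖G k‖ ^ 2 ≤ lam * X := by
    have := integral_norm_sq_sum_exp_comp_le hc hθ hθ' hmaps S fun n => star (ψ n)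
    simpa only [norm_star] using this
  rw [integral_const_mul, integral_add (hF2.const_mul _) (hG2.const_mul _), integral_const_mul,
    integral_const_mul] at h1
  have h3 : lam⁻¹ * ∫ k in Ioo (-r) r, ‖G k‖ ^ 2 ≤ X := by
    rw [inv_mul_le_iff₀ hlam0]
    exact h2
  linarith

/-! ### Potential energy of wave packets -/

theorem exists_Ico_sub_le_sum {d : ℤ → ℝ} (hds : Summable d) {ε : ℝ}
    (hε : 0 < ε) : ∃ (m : ℤ) (L : ℕ), ∑' n, d n - ε ≤ ∑ n ∈ Finset.Ico m (m + L), d n := by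
  obtain ⟨S, hS⟩ := (Filter.eventually_atTop.1
    (hds.hasSum.eventually (lt_mem_nhds (sub_lt_self (∑' n, d n) hε))))
  set M := S.sup Int.natAbs with hM
  refine ⟨-M, 2 * M + 1, ?_⟩
  refine (hS _ ?_).le
  intro n hn
  have : n.natAbs ≤ M := Finset.le_sup (f := Int.natAbs) hn
  rw [Finset.mem_Ico]
  push_cast
  omega

/-- Apply the block decomposition to `d / γ`. Functionals with `s √μ ≥ t` are required to vanish;
the others have `μ ≤ t² / s²` and together cost at most `t² / s²` times `∑ |ψ|²`. The list does not
depend on `t`, as the layer-cake argument demands; `t₀` only fixes a finite window. -/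
theorem exists_functionals_of_grad_le {V : Type*} [AddCommGroup V] [Module ℂ V]
    (ψ : V →ₗ[ℂ] (ℤ → ℂ)) (E₀ E₁ : V → ℝ) {A₀ A₁ : ℝ} (hA₀ : 0 < A₀) (hA₁ : 0 < A₁)
    (h₀ : ∀ F (S : Finset ℤ), ∑ n ∈ S, ‖ψ F n‖ ^ 2 ≤ A₀ * E₀ F)
    (h₁ : ∀ F (S : Finset ℤ), ∑ n ∈ S, ‖ψ F (n + 1) - ψ F n‖ ^ 2 ≤ A₁ * E₁ F)
    {α β : ℝ} (hα : 0 < α) (hβ : 0 < β) :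
    ∃ C : ℝ, 0 ≤ C ∧ ∀ d : ℤ → ℝ, (∀ n, 0 ≤ d n) → Summable d → ∀ t₀ : ℝ, 0 < t₀ →
      ∃ l : List (ℝ × (V →ₗ[ℂ] ℂ)), (∀ x ∈ l, 0 ≤ x.1) ∧
        (l.map fun x => x.1).sum ≤ C * ∑' n, d n ∧
        ∀ t, t₀ ≤ t → ∀ F, (∀ x ∈ l, t ≤ x.1 → x.2 F = 0) →
          ∑' n, d n * ‖ψ F n‖ ^ 2 ≤ α * E₁ F + β * t ^ 2 * E₀ F := by
  -- `γ` turns gradient energy into `α E₁`, and `s` is chosen so that `γ A₀ / s² = β / 2`; the other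
  -- half of `β` absorbs the tail outside the window.
  set γ := α / A₁ with hγ
  have hγ0 : 0 < γ := by positivity
  set s := Real.sqrt (2 * γ * A₀ / β) with hs
  have hs0 : 0 < s := Real.sqrt_pos.2 (by positivity)
  have hs2 : s ^ 2 = 2 * γ * A₀ / β := Real.sq_sqrt (by positivity)
  refine ⟨8 * s / γ, by positivity, fun d hd hds t₀ ht₀ => ?_⟩
  obtain ⟨m, L, hmL⟩ := exists_Ico_sub_le_sum hds
    (ε := β * t₀ ^ 2 / (2 * A₀)) (by positivity)
  obtain ⟨L', l, -, hl0, hl1, hl2, hl3⟩ :=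
    exists_list_sum_mul_norm_sq_le (d := fun n => γ⁻¹ * d n)
      (fun n => mul_nonneg (inv_nonneg.2 hγ0.le) (hd n)) L m
  refine ⟨l.map fun x => (s * Real.sqrt x.1, x.2 ∘ₗ ψ), ?_, ?_, ?_⟩
  · intro x hx
    obtain ⟨y, -, rfl⟩ := List.mem_map.1 hx
    positivity
  · rw [List.map_map]
    have e : ((fun x : ℝ × (V →ₗ[ℂ] ℂ) => x.1) ∘
        fun x : ℝ × ((ℤ → ℂ) →ₗ[ℂ] ℂ) => (s * Real.sqrt x.1, x.2 ∘ₗ ψ)) =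
        fun x => s * Real.sqrt x.1 := rfl
    rw [e, List.sum_map_mul_left]
    have h1 : (l.map fun x => Real.sqrt x.1).sum ≤ 8 * (γ⁻¹ * ∑' n, d n) := by
      refine hl3.trans ?_
      have h2 : ∑ n ∈ Finset.Ico m (m + L), γ⁻¹ * d n ≤ γ⁻¹ * ∑' n, d n := by
        rw [← Finset.mul_sum]
        gcongr
        exact hds.sum_le_tsum _ fun n _ => hd n
      have h3 : 0 ≤ if L = 0 then 0 else γ⁻¹ * d m := by
        have := hd m
        split_ifs <;> positivity
      linarith
    calc s * (l.map fun x => Real.sqrt x.1).sum ≤ s * (8 * (γ⁻¹ * ∑' n, d n)) := by gcongr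
      _ = _ := by ring
  · intro t ht F hF
    have hpt : ∀ n, ‖ψ F n‖ ^ 2 ≤ A₀ * E₀ F := fun n => by simpa using h₀ F {n}
    have hE₀ : 0 ≤ E₀ F := by
      have := (sq_nonneg _).trans (hpt 0)
      exact nonneg_of_mul_nonneg_right this hA₀
    set W := Finset.Ico m (m + L) with hW
    have hwin : ∀ f : ℤ → ℝ, HasSum (fun n => if n ∈ W then f n else 0) (∑ n ∈ W, f n) := by
      intro f
      have : HasSum (fun n => if n ∈ W then f n else 0)
          (∑ n ∈ W, if n ∈ W then f n else 0) :=
        hasSum_sum_of_ne_finset_zero fun n hn => if_neg hn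
      rwa [Finset.sum_congr rfl fun n hn => if_pos hn] at this
    have htail : ∑' n, d n * ‖ψ F n‖ ^ 2 ≤
        ∑ n ∈ W, d n * ‖ψ F n‖ ^ 2 + (∑' n, d n - ∑ n ∈ W, d n) * (A₀ * E₀ F) := by
      have hR := (hwin fun n => d n * ‖ψ F n‖ ^ 2).add
        ((hds.hasSum.sub (hwin d)).mul_right (A₀ * E₀ F))
      have hL : Summable fun n => d n * ‖ψ F n‖ ^ 2 :=
        Summable.of_nonneg_of_le (fun n => mul_nonneg (hd n) (by positivity))
          (fun n => mul_le_mul_of_nonneg_left (hpt n) (hd n)) (hds.mul_right _)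
      refine hasSum_le (fun n => ?_) hL.hasSum hR
      by_cases hn : n ∈ W
      · simp [hn]
      · simp only [if_neg hn, zero_add, sub_zero]
        exact mul_le_mul_of_nonneg_left (hpt n) (hd n)
    have htail2 : (∑' n, d n - ∑ n ∈ W, d n) * (A₀ * E₀ F) ≤ β / 2 * t ^ 2 * E₀ F := by
      calc (∑' n, d n - ∑ n ∈ W, d n) * (A₀ * E₀ F)
          ≤ β * t₀ ^ 2 / (2 * A₀) * (A₀ * E₀ F) := by
            gcongr
            linarith
        _ = β / 2 * t₀ ^ 2 * E₀ F := by field_simp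
        _ ≤ _ := by gcongr
    have hlist : (l.map fun x => x.1 * ‖x.2 (ψ F)‖ ^ 2).sum ≤
        (l.map fun x => t ^ 2 / s ^ 2 * ‖x.2 (ψ F)‖ ^ 2).sum := by
      refine List.sum_le_sum fun x hx => ?_
      by_cases htx : t ≤ s * Real.sqrt x.1
      · have : x.2 (ψ F) = 0 :=
          hF (s * Real.sqrt x.1, x.2 ∘ₗ ψ) (List.mem_map.2 ⟨x, hx, rfl⟩) htx
        simp [this]
      · have hx0 := hl0 x hx
        gcongr
        rw [le_div_iff₀ (by positivity)]
        calc x.1 * s ^ 2 = (s * Real.sqrt x.1) ^ 2 := by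
              rw [mul_pow, Real.sq_sqrt hx0]; ring
          _ ≤ t ^ 2 := by
              have := (not_le.1 htx).le
              gcongr
    rw [List.sum_map_mul_left] at hlist
    have hB : (l.map fun x => ‖x.2 (ψ F)‖ ^ 2).sum ≤ A₀ * E₀ F := (hl2 (ψ F)).trans (h₀ F _)
    have hmain : ∑ n ∈ W, d n * ‖ψ F n‖ ^ 2 ≤ α * E₁ F + β / 2 * t ^ 2 * E₀ F := by
      have h3 := hl1 (ψ F)
      have h4 := h₁ F (Finset.Ico m (m + L'))
      have h5 : ∑ n ∈ W, d n * ‖ψ F n‖ ^ 2 = γ * ∑ n ∈ W, γ⁻¹ * d n * ‖ψ F n‖ ^ 2 := by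
        rw [Finset.mul_sum]
        refine Finset.sum_congr rfl fun n _ => ?_
        field_simp
      rw [h5]
      calc γ * ∑ n ∈ W, γ⁻¹ * d n * ‖ψ F n‖ ^ 2
          ≤ γ * (A₁ * E₁ F + t ^ 2 / s ^ 2 * (A₀ * E₀ F)) := by
            gcongr
            refine h3.trans (add_le_add h4 (hlist.trans ?_))
            gcongr
        _ = _ := by
            rw [hs2, hγ]
            field_simp
    linarith

theorem lpTwo_norm_sq_eq {X : Type*} [MeasurableSpace X] {μ : Measure X} (F : Lp ℂ 2 μ) :
    ‖F‖ ^ 2 = ∫ k, ‖F k‖ ^ 2 ∂μ := by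
  have h : ((‖F‖ ^ 2 : ℝ) : ℂ) = ((∫ k, ‖F k‖ ^ 2 ∂μ : ℝ) : ℂ) := by
    have h1 := inner_self_eq_norm_sq_to_K (𝕜 := ℂ) F
    rw [L2.inner_def] at h1
    rw [← integral_complex_ofReal]
    push_cast
    refine Eq.trans h1.symm (integral_congr_ae (Filter.Eventually.of_forall fun k => ?_))
    exact inner_self_eq_norm_sq_to_K (𝕜 := ℂ) (F k)
  exact_mod_cast h

/-- The constant depends only on the measure, so the bound on the representing vectors is uniform
over a family of kernels. -/
theorem exists_inner_eq_integral_mul {X : Type*} [MeasurableSpace X] (μ : Measure X)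
    [IsFiniteMeasure μ] : ∃ K : ℝ, 0 ≤ K ∧ ∀ (w : X → ℂ) (C : ℝ), AEStronglyMeasurable w μ → 0 ≤ C →
      (∀ᵐ k ∂μ, ‖w k‖ ≤ C) → ∃ g : Lp ℂ 2 μ, ‖g‖ ≤ K * C ∧
        ∀ F : Lp ℂ 2 μ, inner ℂ g F = ∫ k, F k * w k ∂μ := by
  refine ⟨(measureUnivNNReal μ : ℝ) ^ ((2 : ℝ≥0∞).toReal)⁻¹, by positivity, fun w C hw hC hwC => ?_⟩
  have hm : MemLp (fun k => star (w k)) 2 μ := by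
    refine MemLp.of_bound (C := C) (hw.star) ?_
    simpa only [norm_star] using hwC
  refine ⟨hm.toLp, ?_, fun F => ?_⟩
  · refine Lp.norm_le_of_ae_bound hC ?_
    filter_upwards [hm.coeFn_toLp, hwC] with k h1 h2
    rw [h1, norm_star]
    exact h2
  · rw [L2.inner_def]
    refine integral_congr_ae ?_
    filter_upwards [hm.coeFn_toLp] with k h1
    rw [h1]
    simp [RCLike.inner_apply]

/-- Multiplication by a bounded function on `L²`. -/
theorem exists_mulLp {X : Type*} [MeasurableSpace X] (μ : Measure X) (w : X → ℂ) {C : ℝ}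
    (hw : AEStronglyMeasurable w μ) (hwC : ∀ᵐ k ∂μ, ‖w k‖ ≤ C) :
    ∃ M : Lp ℂ 2 μ →ₗ[ℂ] Lp ℂ 2 μ, ∀ F, M F =ᵐ[μ] fun k => w k * F k := by
  have hm : ∀ F : Lp ℂ 2 μ, MemLp (fun k => w k * F k) 2 μ := fun F => by
    refine MemLp.of_le_mul (c := C) (Lp.memLp F) (hw.mul (Lp.aestronglyMeasurable F)) ?_
    filter_upwards [hwC] with k hk
    rw [norm_mul]
    gcongr
  refine ⟨{ toFun := fun F => (hm F).toLp, map_add' := fun F G => ?_, map_smul' := fun c F => ?_ },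
    fun F => (hm F).coeFn_toLp⟩
  · refine Lp.ext ?_
    filter_upwards [(hm (F + G)).coeFn_toLp, (hm F).coeFn_toLp, (hm G).coeFn_toLp,
      Lp.coeFn_add F G, Lp.coeFn_add (hm F).toLp (hm G).toLp] with k h1 h2 h3 h4 h5
    rw [h1, h5, Pi.add_apply, h2, h3, h4, Pi.add_apply, mul_add]
  · refine Lp.ext ?_
    filter_upwards [(hm (c • F)).coeFn_toLp, (hm F).coeFn_toLp, Lp.coeFn_smul c F,
      Lp.coeFn_smul c (hm F).toLp] with k h1 h2 h3 h4
    rw [RingHom.id_apply, h1, h4, Pi.smul_apply, h2, h3, Pi.smul_apply, smul_eq_mul, smul_eq_mul]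
    ring

theorem norm_exp_I_mul_sub_one_le_abs (x : ℝ) : ‖Complex.exp (Complex.I * x) - 1‖ ≤ |x| := by
  simpa using Real.norm_exp_I_mul_ofReal_sub_one_le (x := x)

/-- Increasing `n` by one multiplies the transform by `exp (i θ)`. The discrete gradient therefore
has transform `F (exp (i θ) - 1)`, bounded by `Λ |k| |F|`, and Bessel's inequality supplies both
hypotheses of `exists_functionals_of_grad_le`. -/
theorem exists_functionals_of_plane_wave {δ r : ℝ} (hrδ : r ≤ δ) {θ θ' : ℝ → ℝ} {c : ℝ}
    (hc : 0 < c) (hθ : ∀ k ∈ Ioo (-r) r, HasDerivAt θ (θ' k) k)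
    (hθ' : ∀ k ∈ Ioo (-r) r, c ≤ θ' k)
    (hmaps : MapsTo θ (Ioo (-r) r) (Ioc (-Real.pi) Real.pi)) {Λ : ℝ} (hΛ : 0 < Λ)
    (hθΛ : ∀ k ∈ Ioo (-r) r, |θ k| ≤ Λ * |k|) {α β : ℝ} (hα : 0 < α) (hβ : 0 < β) :
    ∃ C : ℝ, 0 ≤ C ∧ ∀ d : ℤ → ℝ, (∀ n, 0 ≤ d n) → Summable d → ∀ t₀ : ℝ, 0 < t₀ →
      ∃ l : List (ℝ × (Lp ℂ 2 (volume.restrict (Ioo (-δ) δ)) →ₗ[ℂ] ℂ)), (∀ x ∈ l, 0 ≤ x.1) ∧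
        (l.map fun x => x.1).sum ≤ C * ∑' n, d n ∧
        ∀ t, t₀ ≤ t → ∀ F : Lp ℂ 2 (volume.restrict (Ioo (-δ) δ)),
          (∀ x ∈ l, t ≤ x.1 → x.2 F = 0) →
          ∑' n, d n * ‖∫ k in Ioo (-r) r, F k * Complex.exp (Complex.I * θ k * n)‖ ^ 2 ≤
            α * (∫ k in Ioo (-δ) δ, k ^ 2 * ‖F k‖ ^ 2) +
              β * t ^ 2 * ∫ k in Ioo (-δ) δ, ‖F k‖ ^ 2 := by
  have hsub : Ioo (-r) r ⊆ Ioo (-δ) δ := Ioo_subset_Ioo (by linarith) hrδ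
  have hle : volume.restrict (Ioo (-r) r) ≤ volume.restrict (Ioo (-δ) δ) :=
    Measure.restrict_mono hsub le_rfl
  have hθc : ContinuousOn θ (Ioo (-r) r) := fun k hk => (hθ k hk).continuousAt.continuousWithinAt
  have hexp : ∀ n : ℤ, AEStronglyMeasurable (fun k => Complex.exp (Complex.I * θ k * n))
      (volume.restrict (Ioo (-r) r)) := fun n =>
    ContinuousOn.aestronglyMeasurable (by fun_prop) measurableSet_Ioo
  have hFm : ∀ F : Lp ℂ 2 (volume.restrict (Ioo (-δ) δ)),
      MemLp F 2 (volume.restrict (Ioo (-r) r)) := fun F => (Lp.memLp F).mono_measure hle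
  have hFe : ∀ (F : Lp ℂ 2 (volume.restrict (Ioo (-δ) δ))) (n : ℤ),
      Integrable (fun k => F k * Complex.exp (Complex.I * θ k * n))
      (volume.restrict (Ioo (-r) r)) := fun F n =>
    ((hFm F).integrable (by norm_num)).mul_bdd (c := 1) (hexp n)
      (Filter.Eventually.of_forall fun k => (norm_exp_I_mul_ofReal_mul_int _ _).le)
  let ψ : Lp ℂ 2 (volume.restrict (Ioo (-δ) δ)) →ₗ[ℂ] (ℤ → ℂ) :=
    { toFun := fun F n => ∫ k in Ioo (-r) r, F k * Complex.exp (Complex.I * θ k * n)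
      map_add' := fun F G => by
        funext n
        rw [Pi.add_apply, ← integral_add (hFe F n) (hFe G n)]
        refine integral_congr_ae ?_
        filter_upwards [Filter.Eventually.filter_mono (ae_mono hle) (Lp.coeFn_add F G)] with k hk
        rw [hk, Pi.add_apply, add_mul]
      map_smul' := fun z F => by
        funext n
        rw [Pi.smul_apply, smul_eq_mul, RingHom.id_apply, ← integral_const_mul]
        refine integral_congr_ae ?_
        filter_upwards [Filter.Eventually.filter_mono (ae_mono hle) (Lp.coeFn_smul z F)] with k hk
        rw [hk, Pi.smul_apply, smul_eq_mul, mul_assoc] }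
  have hF2 : ∀ F : Lp ℂ 2 (volume.restrict (Ioo (-δ) δ)),
      Integrable (fun k => ‖F k‖ ^ 2) (volume.restrict (Ioo (-δ) δ)) := fun F =>
    (memLp_two_iff_integrable_sq_norm (Lp.aestronglyMeasurable F)).1 (Lp.memLp F)
  have hk2F2 : ∀ F : Lp ℂ 2 (volume.restrict (Ioo (-δ) δ)),
      Integrable (fun k => k ^ 2 * ‖F k‖ ^ 2) (volume.restrict (Ioo (-δ) δ)) := fun F => by
    refine (hF2 F).bdd_mul (c := δ ^ 2) (by fun_prop) ?_
    refine (ae_restrict_iff' measurableSet_Ioo).2 (Filter.Eventually.of_forall fun k hk => ?_)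
    rw [Real.norm_of_nonneg (sq_nonneg k)]
    exact sq_le_sq' hk.1.le hk.2.le
  have hcpos : 0 < 2 * Real.pi / c := by positivity
  refine exists_functionals_of_grad_le ψ (fun F => ∫ k in Ioo (-δ) δ, ‖F k‖ ^ 2)
    (fun F => ∫ k in Ioo (-δ) δ, k ^ 2 * ‖F k‖ ^ 2) (A₀ := 2 * Real.pi / c)
    (A₁ := 2 * Real.pi / c * Λ ^ 2) hcpos (by positivity) ?_ ?_ hα hβ
  · intro F S
    refine (sum_norm_integral_mul_exp_sq_le hc hθ hθ' hmaps (hFm F) S).trans ?_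
    refine mul_le_mul_of_nonneg_left ?_ hcpos.le
    exact setIntegral_mono_set (hF2 F) (Filter.Eventually.of_forall fun k => by positivity)
      hsub.eventuallyLE
  · intro F S
    set G : ℝ → ℂ := fun k => F k * (Complex.exp (Complex.I * θ k) - 1) with hG
    have he1 : AEStronglyMeasurable (fun k => Complex.exp (Complex.I * θ k) - 1)
        (volume.restrict (Ioo (-r) r)) :=
      ContinuousOn.aestronglyMeasurable (by fun_prop) measurableSet_Ioo
    have hGle : ∀ k ∈ Ioo (-r) r, ‖G k‖ ≤ Λ * (|k| * ‖F k‖) := by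
      intro k hk
      rw [hG]
      simp only [norm_mul]
      calc ‖F k‖ * ‖Complex.exp (Complex.I * θ k) - 1‖ ≤ ‖F k‖ * (Λ * |k|) := by
            gcongr
            exact (norm_exp_I_mul_sub_one_le_abs _).trans (hθΛ k hk)
        _ = _ := by ring
    have hGm : MemLp G 2 (volume.restrict (Ioo (-r) r)) := by
      refine MemLp.of_le_mul (c := Λ * r) (hFm F) ((hFm F).1.mul he1) ?_
      refine (ae_restrict_iff' measurableSet_Ioo).2 (Filter.Eventually.of_forall fun k hk => ?_)
      refine (hGle k hk).trans ?_
      rw [mul_assoc]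
      gcongr
      exact (abs_lt.2 hk).le
    have hdiff : ∀ n, ψ F (n + 1) - ψ F n =
        ∫ k in Ioo (-r) r, G k * Complex.exp (Complex.I * θ k * n) := by
      intro n
      change (∫ k in Ioo (-r) r, F k * Complex.exp (Complex.I * θ k * (n + 1 : ℤ))) -
        (∫ k in Ioo (-r) r, F k * Complex.exp (Complex.I * θ k * n)) = _
      rw [← integral_sub (hFe F (n + 1)) (hFe F n)]
      refine integral_congr_ae (Filter.Eventually.of_forall fun k => ?_)
      have : Complex.exp (Complex.I * θ k * (n + 1 : ℤ)) =
          Complex.exp (Complex.I * θ k * n) * Complex.exp (Complex.I * θ k) := by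
        rw [← Complex.exp_add]
        congr 1
        push_cast
        ring
      simp only [this, hG]
      ring
    simp_rw [hdiff]
    refine (sum_norm_integral_mul_exp_sq_le hc hθ hθ' hmaps hGm S).trans ?_
    rw [mul_assoc (2 * Real.pi / c)]
    refine mul_le_mul_of_nonneg_left ?_ hcpos.le
    rw [← integral_const_mul]
    calc ∫ k in Ioo (-r) r, ‖G k‖ ^ 2 ≤ ∫ k in Ioo (-r) r, Λ ^ 2 * (k ^ 2 * ‖F k‖ ^ 2) := by
          refine setIntegral_mono_on ((memLp_two_iff_integrable_sq_norm hGm.1).1 hGm)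
            (((hk2F2 F).mono_measure hle).const_mul _) measurableSet_Ioo fun k hk => ?_
          calc ‖G k‖ ^ 2 ≤ (Λ * (|k| * ‖F k‖)) ^ 2 := by
                gcongr
                exact hGle k hk
            _ = _ := by rw [mul_pow, mul_pow, sq_abs]
      _ ≤ _ := setIntegral_mono_set ((hk2F2 F).const_mul _)
          (Filter.Eventually.of_forall fun k => by positivity) hsub.eventuallyLE

/-- Bound for the potential energy of a wave packet `∫ F(k) u_n(k) dk` by the kinetic energy
`∫ k² |F(k)|² dk`, on the common kernel of finitely many functionals. -/
theorem exists_functionals_of_expansion {δ r : ℝ} (hr : 0 < r) (hrδ : r ≤ δ)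
    {u : ℤ → ℝ → ℂ} (hu_meas : ∀ n, AEStronglyMeasurable (u n) (volume.restrict (Ioo (-δ) δ)))
    {c₂ : ℝ} (hc₂ : 0 < c₂) (hu : ∀ k ∈ Ioo (-δ) δ, ∀ n, ‖u n k‖ ≤ c₂)
    {v₀ : ℤ → ℂ} (hv₀ : ∀ n, ‖v₀ n‖ ≤ c₂)
    {θ θ' : ℝ → ℝ} {c : ℝ}
    (hc : 0 < c) (hθ : ∀ k ∈ Ioo (-r) r, HasDerivAt θ (θ' k) k)
    (hθ' : ∀ k ∈ Ioo (-r) r, c ≤ θ' k)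
    (hmaps : MapsTo θ (Ioo (-r) r) (Ioc (-Real.pi) Real.pi)) {Λ : ℝ} (hΛ : 0 < Λ)
    (hθΛ : ∀ k ∈ Ioo (-r) r, |θ k| ≤ Λ * |k|) {c₃ : ℝ} (hc₃ : 0 ≤ c₃)
    (huv : ∀ k ∈ Ioo (-r) r, ∀ n, ‖u n k - v₀ n * Complex.exp (Complex.I * θ k * n)‖ ≤ c₃ * k ^ 2)
    {α β : ℝ} (hα : 0 < α) (hβ : 0 < β) :
    ∃ C₁ C₂ : ℝ, 0 ≤ C₁ ∧ 0 ≤ C₂ ∧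
      ∀ d : ℤ → ℝ, (∀ n, 0 ≤ d n) → Summable d → ∀ t₀ : ℝ, 0 < t₀ →
      ∃ (N : ℕ) (f : Fin N → (Lp ℂ 2 (volume.restrict (Ioo (-δ) δ)) →ₗ[ℂ] ℂ))
        (l : List (ℝ × (Lp ℂ 2 (volume.restrict (Ioo (-δ) δ)) →ₗ[ℂ] ℂ))),
        (N : ℝ) ≤ C₁ * ∑' n, d n ∧ (∀ x ∈ l, 0 ≤ x.1) ∧
        (l.map fun x => x.1).sum ≤ C₂ * ∑' n, d n ∧
        ∀ t, t₀ ≤ t → ∀ F : Lp ℂ 2 (volume.restrict (Ioo (-δ) δ)),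
          (∀ i, f i F = 0) → (∀ x ∈ l, t ≤ x.1 → x.2 F = 0) →
          ∑' n, d n * ‖∫ k in Ioo (-δ) δ, F k * u n k‖ ^ 2 ≤
            α * (∫ k in Ioo (-δ) δ, k ^ 2 * ‖F k‖ ^ 2) +
              β * t ^ 2 * ∫ k in Ioo (-δ) δ, ‖F k‖ ^ 2 := by
  have hδ : 0 < δ := hr.trans_le hrδ
  have hsub : Ioo (-r) r ⊆ Ioo (-δ) δ := Ioo_subset_Ioo (by linarith) hrδ
  have hθc : ContinuousOn θ (Ioo (-r) r) := fun k hk => (hθ k hk).continuousAt.continuousWithinAt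
  set μ := volume.restrict (Ioo (-δ) δ) with hμ
  have hexp : ∀ n : ℤ, AEStronglyMeasurable (fun k => Complex.exp (Complex.I * θ k * n))
      (volume.restrict (Ioo (-r) r)) := fun n =>
    ContinuousOn.aestronglyMeasurable (by fun_prop) measurableSet_Ioo
  set e : ℤ → ℝ → ℂ := fun n => (Ioo (-r) r).indicator
    fun k => Complex.exp (Complex.I * θ k * n) with he
  have hem : ∀ n, AEStronglyMeasurable (e n) μ := fun n =>
    ((aestronglyMeasurable_indicator_iff measurableSet_Ioo).2 (hexp n)).mono_measure
      Measure.restrict_le_self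
  have heb : ∀ n k, ‖e n k‖ ≤ 1 := by
    intro n k
    refine (norm_indicator_le_norm_self _ _).trans (norm_exp_I_mul_ofReal_mul_int _ _).le
  -- The remainder after removing the plane wave, divided by `k`. It is bounded uniformly in `n`:
  -- near 0 the remainder is `O(k²)`, and for `|k| ≥ r` the plane wave is cut off and `1 / |k| ≤ 1 /
  -- r`. Paired with `k F`, it gives a form of finite trace relative to `∫ k² |F|²`.
  set ρ : ℤ → ℝ → ℂ := fun n k => (u n k - v₀ n * e n k) * ((k⁻¹ : ℝ) : ℂ) with hρ
  have hρm : ∀ n, AEStronglyMeasurable (ρ n) μ := fun n => by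
    refine ((hu_meas n).sub ((hem n).const_mul _)).mul ?_
    exact (Complex.measurable_ofReal.comp measurable_inv).aestronglyMeasurable
  have hρb : ∀ n, ∀ k ∈ Ioo (-δ) δ, ‖ρ n k‖ ≤ c₃ * δ + c₂ / r := by
    intro n k hk
    have hkδ : |k| < δ := abs_lt.2 hk
    rw [hρ]
    simp only [norm_mul, Complex.norm_real, norm_inv, Real.norm_eq_abs]
    by_cases hkr : k ∈ Ioo (-r) r
    · have h1 := huv k hkr n
      simp only [he, indicator_of_mem hkr]
      rcases eq_or_ne k 0 with rfl | hk0
      · simp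
        positivity
      · have hk0' : 0 < |k| := abs_pos.2 hk0
        calc _ ≤ c₃ * k ^ 2 * |k|⁻¹ := by gcongr
          _ = c₃ * |k| := by rw [← sq_abs]; field_simp
          _ ≤ c₃ * δ + c₂ / r := by
            have : c₃ * |k| ≤ c₃ * δ := by gcongr
            have : 0 ≤ c₂ / r := by positivity
            linarith
    · simp only [he, indicator_of_notMem hkr, mul_zero, sub_zero]
      have hrk : r ≤ |k| := by
        by_contra! h
        exact hkr (abs_lt.1 h)
      calc ‖u n k‖ * |k|⁻¹ ≤ c₂ * r⁻¹ := by
            gcongr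
            exact hu k hk n
        _ ≤ _ := by
          rw [← div_eq_mul_inv]
          have : 0 ≤ c₃ * δ := by positivity
          linarith
  have hρident : ∀ n k, ρ n k * k = u n k - v₀ n * e n k ∨ k = 0 := by
    intro n k
    rcases eq_or_ne k 0 with rfl | hk0
    · exact Or.inr rfl
    · left
      simp only [hρ]
      rw [mul_assoc, ← Complex.ofReal_mul, inv_mul_cancel₀ hk0, Complex.ofReal_one, mul_one]
  obtain ⟨K, hK0, hK⟩ := exists_inner_eq_integral_mul μ
  have hC0 : 0 ≤ c₃ * δ + c₂ / r := by positivity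
  choose g hg1 hg2 using fun n => hK (ρ n) (c₃ * δ + c₂ / r) (hρm n) hC0
    ((ae_restrict_iff' measurableSet_Ioo).2 (Filter.Eventually.of_forall (hρb n)))
  obtain ⟨M, hM⟩ := exists_mulLp μ (fun k : ℝ => (k : ℂ)) (C := δ)
    Complex.measurable_ofReal.aestronglyMeasurable
    ((ae_restrict_iff' measurableSet_Ioo).2 (Filter.Eventually.of_forall fun k hk => by
      rw [Complex.norm_real]
      exact (abs_lt.2 hk).le))
  have hMnorm : ∀ F, ‖M F‖ ^ 2 = ∫ k, k ^ 2 * ‖F k‖ ^ 2 ∂μ := by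
    intro F
    rw [lpTwo_norm_sq_eq]
    refine integral_congr_ae ?_
    filter_upwards [hM F] with k hk
    rw [hk, norm_mul, mul_pow, Complex.norm_real, Real.norm_eq_abs, sq_abs]
  have hFi : ∀ F : Lp ℂ 2 μ, Integrable F μ := fun F => (Lp.memLp F).integrable (by norm_num)
  have hwave : ∀ (F : Lp ℂ 2 μ) (n : ℤ),
      ∫ k in Ioo (-r) r, F k * Complex.exp (Complex.I * θ k * n) = ∫ k, F k * e n k ∂μ := by
    intro F n
    have h := setIntegral_indicator (μ := volume) (s := Ioo (-δ) δ) (t := Ioo (-r) r)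
      measurableSet_Ioo (f := fun k => F k * Complex.exp (Complex.I * θ k * n))
    rw [inter_eq_self_of_subset_right hsub] at h
    refine h.symm.trans (integral_congr_ae (Filter.Eventually.of_forall fun k => ?_))
    simp only [he, indicator_apply]
    split_ifs <;> simp
  have hsplit : ∀ (F : Lp ℂ 2 μ) (n : ℤ), ∫ k, F k * u n k ∂μ =
      v₀ n * (∫ k in Ioo (-r) r, F k * Complex.exp (Complex.I * θ k * n)) +
        inner ℂ (g n) (M F) := by
    intro F n
    have hFu : Integrable (fun k => F k * u n k) μ :=
      (hFi F).mul_bdd (c := c₂) (hu_meas n)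
        ((ae_restrict_iff' measurableSet_Ioo).2 (Filter.Eventually.of_forall fun k hk => hu k hk n))
    have hFe : Integrable (fun k => F k * e n k) μ :=
      (hFi F).mul_bdd (c := 1) (hem n) (Filter.Eventually.of_forall (heb n))
    have h2 : ∫ k, M F k * ρ n k ∂μ = ∫ k, (F k * u n k - v₀ n * (F k * e n k)) ∂μ := by
      have h0 : ∀ᵐ k ∂μ, k ≠ 0 := by
        refine ae_restrict_of_ae ?_
        exact (Measure.ae_ne volume 0)
      refine integral_congr_ae ?_
      filter_upwards [hM F, h0] with k hk hk0
      have := (hρident n k).resolve_right hk0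
      rw [hk]
      calc (k : ℂ) * F k * ρ n k = F k * (ρ n k * k) := by ring
        _ = _ := by rw [this]; ring
    rw [hg2, h2, hwave, integral_sub hFu (hFe.const_mul _), integral_const_mul]
    ring
  -- Squaring the sum of the two parts costs a factor 2. With these parameters and `η = α / 4` for
  -- the remainder, each part contributes `α / 2` to the kinetic term.
  obtain ⟨C₂, hC₂, hplane⟩ := exists_functionals_of_plane_wave hrδ hc hθ hθ' hmaps hΛ hθΛ
    (α := α / (4 * c₂ ^ 2)) (β := β / (2 * c₂ ^ 2)) (by positivity) (by positivity)
  have hg3 : ∀ n, ‖g n‖ ^ 2 ≤ (K * (c₃ * δ + c₂ / r)) ^ 2 := fun n => by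
    gcongr
    exact hg1 n
  refine ⟨(K * (c₃ * δ + c₂ / r)) ^ 2 / (α / 4), C₂, by positivity, hC₂, fun d hd hds t₀ ht₀ => ?_⟩
  obtain ⟨l, hl0, hl1, hl2⟩ := hplane d hd hds t₀ ht₀
  obtain ⟨N, f, hN, hf⟩ := exists_orthogonal_tsum_le hd hds g hg3 (η := α / 4) (by positivity)
  refine ⟨N, fun i => (innerSL ℂ (f i)).toLinearMap ∘ₗ M, l, ?_, hl0, hl1, ?_⟩
  · rw [div_mul_eq_mul_div, le_div_iff₀ (by positivity)]
    exact hN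
  · intro t ht F hfF hlF
    have h1 := hl2 t ht F hlF
    have h2 := hf (M F) fun i => by simpa using hfF i
    rw [hMnorm] at h2
    set I : ℤ → ℂ := fun n => ∫ k in Ioo (-r) r, F k * Complex.exp (Complex.I * θ k * n) with hI
    have hIb : ∀ n, ‖I n‖ ≤ ∫ k, ‖F k‖ ∂μ := by
      intro n
      rw [hI]
      simp only [hwave]
      refine norm_integral_le_of_norm_le (hFi F).norm (Filter.Eventually.of_forall fun k => ?_)
      rw [norm_mul]
      exact mul_le_of_le_one_right (norm_nonneg _) (heb n k)
    have hs1 : Summable fun n => d n * ‖I n‖ ^ 2 := by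
      refine Summable.of_nonneg_of_le (fun n => mul_nonneg (hd n) (by positivity)) (fun n => ?_)
        (hds.mul_right ((∫ k, ‖F k‖ ∂μ) ^ 2))
      refine mul_le_mul_of_nonneg_left ?_ (hd n)
      gcongr
      exact hIb n
    have hs2 : Summable fun n => d n * ‖inner ℂ (g n) (M F)‖ ^ 2 := by
      refine Summable.of_nonneg_of_le (fun n => mul_nonneg (hd n) (by positivity)) (fun n => ?_)
        (hds.mul_right ((K * (c₃ * δ + c₂ / r) * ‖M F‖) ^ 2))
      refine mul_le_mul_of_nonneg_left ?_ (hd n)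
      gcongr
      exact (norm_inner_le_norm _ _).trans (mul_le_mul_of_nonneg_right (hg1 n) (norm_nonneg _))
    have hterm : ∀ n, d n * ‖∫ k, F k * u n k ∂μ‖ ^ 2 ≤
        2 * c₂ ^ 2 * (d n * ‖I n‖ ^ 2) + 2 * (d n * ‖inner ℂ (g n) (M F)‖ ^ 2) := by
      intro n
      have : ‖∫ k, F k * u n k ∂μ‖ ^ 2 ≤
          2 * (c₂ ^ 2 * ‖I n‖ ^ 2 + ‖inner ℂ (g n) (M F)‖ ^ 2) := by
        rw [hsplit F n]
        calc _ ≤ (c₂ * ‖I n‖ + ‖inner ℂ (g n) (M F)‖) ^ 2 := by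
              gcongr
              refine (norm_add_le _ _).trans ?_
              rw [norm_mul]
              gcongr
              exact hv₀ n
          _ ≤ 2 * ((c₂ * ‖I n‖) ^ 2 + ‖inner ℂ (g n) (M F)‖ ^ 2) := add_sq_le
          _ = _ := by ring
      calc _ ≤ d n * (2 * (c₂ ^ 2 * ‖I n‖ ^ 2 + ‖inner ℂ (g n) (M F)‖ ^ 2)) :=
            mul_le_mul_of_nonneg_left this (hd n)
        _ = _ := by ring
    have hR := (hs1.mul_left (2 * c₂ ^ 2)).add (hs2.mul_left 2)
    calc ∑' n, d n * ‖∫ k, F k * u n k ∂μ‖ ^ 2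
        ≤ ∑' n, (2 * c₂ ^ 2 * (d n * ‖I n‖ ^ 2) + 2 * (d n * ‖inner ℂ (g n) (M F)‖ ^ 2)) :=
          Summable.tsum_le_tsum hterm (Summable.of_nonneg_of_le
            (fun n => mul_nonneg (hd n) (by positivity)) hterm hR) hR
      _ = 2 * c₂ ^ 2 * ∑' n, d n * ‖I n‖ ^ 2 +
            2 * ∑' n, d n * ‖inner ℂ (g n) (M F)‖ ^ 2 := by
          rw [(hs1.mul_left (2 * c₂ ^ 2)).tsum_add (hs2.mul_left 2), tsum_mul_left, tsum_mul_left]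
      _ ≤ 2 * c₂ ^ 2 * (α / (4 * c₂ ^ 2) * (∫ k, k ^ 2 * ‖F k‖ ^ 2 ∂μ) +
            β / (2 * c₂ ^ 2) * t ^ 2 * ∫ k, ‖F k‖ ^ 2 ∂μ) +
            2 * (α / 4 * ∫ k, k ^ 2 * ‖F k‖ ^ 2 ∂μ) := by gcongr
      _ = _ := by
          field_simp
          ring

/-! ### Energy in the transform, and eigenvectors against a splitting -/

section Energy

variable {H : Type*} [NormedAddCommGroup H] [InnerProductSpace ℂ H] [CompleteSpace H]

/-- Only norms are known in the transform, so the energy comes from polarization: `4 Re ⟪φ, Aφ⟫ = ‖φ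
+ Aφ‖² - ‖φ - Aφ‖²`, and `(1 + E)² - (1 - E)² = 4 E`. The same identity yields integrability of `E
|F|² ρ`. -/
theorem energy_of_transform {A : H →L[ℂ] H} (hA : IsSelfAdjoint A) {b ε δ : ℝ}
    {ρ E : ℝ → ℝ} (hρ_meas : AEStronglyMeasurable ρ (volume.restrict (Ioo (-δ) δ)))
    (T : spectralRangeIco A b (b + ε) →ₗ[ℂ] Lp ℂ 2 (volume.restrict (Ioo (-δ) δ)))
    (hT_diag : ∀ φ ψ : spectralRangeIco A b (b + ε), (ψ : H) = A (φ : H) →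
        ∀ᵐ k ∂(volume.restrict (Ioo (-δ) δ)), T ψ k = (E k : ℂ) * T φ k)
    (hT_norm : ∀ φ : spectralRangeIco A b (b + ε),
      ‖(φ : H)‖ ^ 2 = ∫ k in Ioo (-δ) δ, ‖T φ k‖ ^ 2 * ρ k)
    {ρm ρp : ℝ} (hρm : 0 < ρm) (hρ : ∀ k ∈ Ioo (-δ) δ, ρm ≤ ρ k ∧ ρ k ≤ ρp)
    {c₁ : ℝ} (hc₁ : 0 < c₁) (hE : ∀ k ∈ Ioo (-δ) δ, b + c₁ * k ^ 2 ≤ E k)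
    (φ : spectralRangeIco A b (b + ε)) :
    b * ‖(φ : H)‖ ^ 2 + c₁ * ρm * (∫ k in Ioo (-δ) δ, k ^ 2 * ‖T φ k‖ ^ 2) ≤
        (inner ℂ (φ : H) (A φ)).re ∧
      ρm * (∫ k in Ioo (-δ) δ, ‖T φ k‖ ^ 2) ≤ ‖(φ : H)‖ ^ 2 := by
  have hF2 : ∀ F : Lp ℂ 2 (volume.restrict (Ioo (-δ) δ)),
      Integrable (fun k => ‖F k‖ ^ 2) (volume.restrict (Ioo (-δ) δ)) := fun F =>
    (memLp_two_iff_integrable_sq_norm (Lp.aestronglyMeasurable F)).1 (Lp.memLp F)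
  have hmem : ∀ᵐ k ∂(volume.restrict (Ioo (-δ) δ)), k ∈ Ioo (-δ) δ :=
    ae_restrict_mem measurableSet_Ioo
  have hk2F2 : ∀ F : Lp ℂ 2 (volume.restrict (Ioo (-δ) δ)),
      Integrable (fun k => k ^ 2 * ‖F k‖ ^ 2) (volume.restrict (Ioo (-δ) δ)) := fun F => by
    refine (hF2 F).bdd_mul (c := δ ^ 2) (by fun_prop) ?_
    filter_upwards [hmem] with k hk
    rw [Real.norm_of_nonneg (sq_nonneg k)]
    exact sq_le_sq' hk.1.le hk.2.le
  have hFρ : ∀ F : Lp ℂ 2 (volume.restrict (Ioo (-δ) δ)),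
      Integrable (fun k => ‖F k‖ ^ 2 * ρ k) (volume.restrict (Ioo (-δ) δ)) := fun F => by
    refine (hF2 F).mul_bdd (c := ρp) hρ_meas ?_
    filter_upwards [hmem] with k hk
    rw [Real.norm_of_nonneg (hρm.le.trans (hρ k hk).1)]
    exact (hρ k hk).2
  set F := T φ with hF
  let ψ : spectralRangeIco A b (b + ε) := ⟨A φ, map_mem_spectralRangeIco hA φ.2⟩
  have hψ := hT_diag φ ψ rfl
  have hadd : ∀ᵐ k ∂(volume.restrict (Ioo (-δ) δ)), T (φ + ψ) k = (1 + E k : ℂ) * F k := by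
    rw [map_add]
    filter_upwards [hψ, Lp.coeFn_add (T φ) (T ψ)] with k h1 h2
    rw [h2, Pi.add_apply, h1]
    ring
  have hsub : ∀ᵐ k ∂(volume.restrict (Ioo (-δ) δ)), T (φ - ψ) k = (1 - E k : ℂ) * F k := by
    rw [map_sub]
    filter_upwards [hψ, Lp.coeFn_sub (T φ) (T ψ)] with k h1 h2
    rw [h2, Pi.sub_apply, h1]
    ring
  have hdiff : ∀ᵐ k ∂(volume.restrict (Ioo (-δ) δ)),
      ‖T (φ + ψ) k‖ ^ 2 * ρ k - ‖T (φ - ψ) k‖ ^ 2 * ρ k = 4 * (E k * (‖F k‖ ^ 2 * ρ k)) := by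
    filter_upwards [hadd, hsub] with k h1 h2
    rw [h1, h2, norm_mul, norm_mul]
    have e1 : ‖(1 + E k : ℂ)‖ = |1 + E k| := by
      rw [← Complex.ofReal_one, ← Complex.ofReal_add, Complex.norm_real, Real.norm_eq_abs]
    have e2 : ‖(1 - E k : ℂ)‖ = |1 - E k| := by
      rw [← Complex.ofReal_one, ← Complex.ofReal_sub, Complex.norm_real, Real.norm_eq_abs]
    rw [e1, e2, mul_pow, mul_pow, sq_abs, sq_abs]
    ring
  have hEint : Integrable (fun k => 4 * (E k * (‖F k‖ ^ 2 * ρ k)))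
      (volume.restrict (Ioo (-δ) δ)) :=
    ((hFρ (T (φ + ψ))).sub (hFρ (T (φ - ψ)))).congr hdiff
  have hpol : 4 * (inner ℂ (φ : H) (A φ)).re =
      ∫ k in Ioo (-δ) δ, 4 * (E k * (‖F k‖ ^ 2 * ρ k)) := by
    rw [← integral_congr_ae hdiff, integral_sub (hFρ _) (hFρ _), ← hT_norm, ← hT_norm,
      Submodule.coe_add, Submodule.coe_sub, norm_add_sq (𝕜 := ℂ), norm_sub_sq (𝕜 := ℂ)]
    change 4 * (inner ℂ (φ : H) (A φ)).re = _ + 2 * (inner ℂ (φ : H) (A φ)).re + _ -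
      (_ - 2 * (inner ℂ (φ : H) (A φ)).re + _)
    ring
  constructor
  · have h1 : ∫ k in Ioo (-δ) δ, 4 * (b * (‖F k‖ ^ 2 * ρ k) + c₁ * ρm * (k ^ 2 * ‖F k‖ ^ 2)) ≤
        ∫ k in Ioo (-δ) δ, 4 * (E k * (‖F k‖ ^ 2 * ρ k)) := by
      refine integral_mono_ae ((((hFρ F).const_mul _).add ((hk2F2 F).const_mul _)).const_mul _)
        hEint ?_
      filter_upwards [hmem] with k hk
      have hρk := (hρ k hk).1
      have hρ0 : 0 ≤ ρ k := hρm.le.trans hρk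
      have h2 : (b + c₁ * k ^ 2) * (‖F k‖ ^ 2 * ρ k) ≤ E k * (‖F k‖ ^ 2 * ρ k) := by
        gcongr
        exact hE k hk
      have h3 : c₁ * k ^ 2 * ‖F k‖ ^ 2 * ρm ≤ c₁ * k ^ 2 * ‖F k‖ ^ 2 * ρ k := by gcongr
      linarith
    rw [integral_const_mul, integral_add ((hFρ F).const_mul _) ((hk2F2 F).const_mul _),
      integral_const_mul, integral_const_mul, ← hT_norm φ, ← hpol] at h1
    linarith
  · rw [hT_norm φ, ← integral_const_mul]
    refine integral_mono_ae ((hF2 F).const_mul _) (hFρ F) ?_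
    filter_upwards [hmem] with k hk
    change ρm * ‖F k‖ ^ 2 ≤ ‖F k‖ ^ 2 * ρ k
    rw [mul_comm]
    gcongr
    exact (hρ k hk).1

/-- If `C` is less than `a` on `p` and greater than `e` on `q ⟂ p`, then `p + q` is not a
combination of eigenvectors with eigenvalues in `[a, e]`. -/
theorem eq_zero_of_sum_eigenvectors {C : H →L[ℂ] H} (hC : IsSelfAdjoint C) {ι : Type*} [Fintype ι]
    {φ : ι → H} (hφ : Orthonormal ℂ φ) {ev : ι → ℝ} (hev : ∀ i, C (φ i) = (ev i : ℂ) • φ i)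
    {a e : ℝ} (hle : ∀ i, a ≤ ev i ∧ ev i ≤ e) {x : ι → ℂ} {p q : H}
    (hpq : ∑ i, x i • φ i = p + q) (horth : inner ℂ p q = 0)
    (hp : p ≠ 0 → (inner ℂ p (C p)).re < a * ‖p‖ ^ 2)
    (hq : q ≠ 0 → e * ‖q‖ ^ 2 < (inner ℂ q (C q)).re) : x = 0 := by
  set y := ∑ i, x i • φ i with hy
  set c := (a + e) / 2 with hc
  set r := (e - a) / 2 with hr
  have hnorm : ∀ z : ι → ℂ, ‖∑ i, z i • φ i‖ ^ 2 = ∑ i, ‖z i‖ ^ 2 := by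
    intro z
    have h1 := hφ.inner_sum z z Finset.univ
    have h2 := inner_self_eq_norm_sq_to_K (𝕜 := ℂ) (∑ i, z i • φ i)
    rw [h2] at h1
    have h3 : ((‖∑ i, z i • φ i‖ ^ 2 : ℝ) : ℂ) = ((∑ i, ‖z i‖ ^ 2 : ℝ) : ℂ) := by
      push_cast
      refine h1.trans (Finset.sum_congr rfl fun i _ => ?_)
      exact Complex.conj_mul' _
    exact_mod_cast h3
  have hpq0 : p = 0 ∧ q = 0 → x = 0 := by
    rintro ⟨rfl, rfl⟩
    have h1 := hnorm x
    rw [← hy, hpq] at h1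
    simp only [add_zero, norm_zero] at h1
    have h2 := (Finset.sum_eq_zero_iff_of_nonneg fun i _ => sq_nonneg ‖x i‖).1
      (by rw [← h1]; norm_num)
    funext i
    simpa using h2 i (Finset.mem_univ i)
  by_contra hx
  have hne : p ≠ 0 ∨ q ≠ 0 := by
    by_contra! h
    exact hx (hpq0 h)
  have hι : Nonempty ι := by
    by_contra h
    rw [not_nonempty_iff] at h
    exact hx (Subsingleton.elim _ _)
  have hr0 : 0 ≤ r := by
    obtain ⟨i⟩ := hι
    have := hle i
    rw [hr]
    linarith
  -- Eigenvalues in `[a, e]` are within `r` of the midpoint `c`. Testing `(C - c) y` against `q -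
  -- p`, of the same norm as `y = p + q`, contradicts the strict form bounds.
  have hdev : ‖C y - (c : ℂ) • y‖ ≤ r * ‖y‖ := by
    have h1 : C y - (c : ℂ) • y = ∑ i, (((ev i - c : ℝ) : ℂ) * x i) • φ i := by
      rw [hy, map_sum, Finset.smul_sum, ← Finset.sum_sub_distrib]
      refine Finset.sum_congr rfl fun i _ => ?_
      rw [map_smul, hev, smul_smul, smul_smul, ← sub_smul]
      congr 1
      push_cast
      ring
    refine le_of_sq_le_sq ?_ (by positivity)
    rw [h1, hnorm, mul_pow, hy, hnorm, Finset.mul_sum]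
    refine Finset.sum_le_sum fun i _ => ?_
    rw [norm_mul, mul_pow, Complex.norm_real, Real.norm_eq_abs, sq_abs]
    refine mul_le_mul_of_nonneg_right ?_ (by positivity)
    have := hle i
    refine sq_le_sq' ?_ ?_ <;> rw [hc, hr] <;> linarith
  have horth' : inner ℂ q p = 0 := inner_eq_zero_symm.1 horth
  have hny : ‖y‖ ^ 2 = ‖p‖ ^ 2 + ‖q‖ ^ 2 := by
    rw [hpq, norm_add_sq (𝕜 := ℂ), horth]
    simp
  have hnd : ‖q - p‖ ^ 2 = ‖p‖ ^ 2 + ‖q‖ ^ 2 := by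
    rw [norm_sub_sq (𝕜 := ℂ), horth']
    simp
    ring
  have hnd' : ‖q - p‖ = ‖y‖ := by
    rw [← Real.sqrt_sq (norm_nonneg y), hny, ← hnd, Real.sqrt_sq (norm_nonneg _)]
  have hup : (inner ℂ (q - p) (C y - (c : ℂ) • y)).re ≤ r * (‖p‖ ^ 2 + ‖q‖ ^ 2) := by
    calc _ ≤ ‖inner ℂ (q - p) (C y - (c : ℂ) • y)‖ := Complex.re_le_norm _
      _ ≤ ‖q - p‖ * ‖C y - (c : ℂ) • y‖ := norm_inner_le_norm _ _
      _ ≤ ‖y‖ * (r * ‖y‖) := by rw [hnd']; gcongr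
      _ = _ := by rw [← hny]; ring
  have hsymm : (inner ℂ q (C p)).re = (inner ℂ p (C q)).re := by
    have h1 := hC.isSymmetric q p
    simp only [ContinuousLinearMap.coe_coe] at h1
    rw [← h1, ← inner_conj_symm, Complex.conj_re]
  have hself : ∀ z : H, (inner ℂ z z).re = ‖z‖ ^ 2 := fun z => by
    have := inner_self_eq_norm_sq (𝕜 := ℂ) z
    simpa using this
  -- The subspaces of `p` and `q` need not reduce `C`: the real parts of the two cross terms cancel
  -- by selfadjointness.
  have hexpand : (inner ℂ (q - p) (C y - (c : ℂ) • y)).re =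
      (inner ℂ q (C q)).re - (inner ℂ p (C p)).re - c * ‖q‖ ^ 2 + c * ‖p‖ ^ 2 := by
    rw [hpq, map_add]
    simp only [inner_sub_left, inner_sub_right, inner_add_right, inner_smul_right, horth, horth',
      smul_add, Complex.sub_re, Complex.add_re, hsymm, Complex.re_ofReal_mul, hself,
      Complex.zero_re]
    ring
  rw [hexpand] at hup
  have hq' : e * ‖q‖ ^ 2 ≤ (inner ℂ q (C q)).re := by
    by_cases h : q = 0
    · simp [h]
    · exact (hq h).le
  have hp' : (inner ℂ p (C p)).re ≤ a * ‖p‖ ^ 2 := by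
    by_cases h : p = 0
    · simp [h]
    · exact (hp h).le
  have e1 : e = c + r := by rw [hc, hr]; ring
  have e2 : a = c - r := by rw [hc, hr]; ring
  rw [e1] at hq hq'
  rw [e2] at hp hp'
  rcases hne with h | h
  · have := hp h
    linarith
  · have := hq h
    linarith

end Energy

/-! ### Assembling the splitting for `J₀` -/

/-- Since `a` itself is in the open resolvent set, the gap extends to the left of `a`; this is the
margin for the part below the gap. -/
theorem exists_gap_left {A : EllTwo →L[ℂ] EllTwo} {a b : ℝ} (hab : a < b)
    (hgap : Ico a b ∩ spectrum ℝ A = ∅) :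
    ∃ η > 0, ∀ x ∈ spectrum ℝ A, x < b → x ≤ a - η := by
  have hcl : IsClosed (spectrum ℝ A) := spectrum.isClosed A
  have ha : a ∈ (spectrum ℝ A)ᶜ := fun h => by
    have : a ∈ Ico a b ∩ spectrum ℝ A := ⟨⟨le_rfl, hab⟩, h⟩
    rw [hgap] at this
    exact this
  obtain ⟨η, hη, hball⟩ := Metric.isOpen_iff.1 hcl.isOpen_compl a ha
  refine ⟨η, hη, fun x hx hxb => ?_⟩
  have hxa : x < a := by
    by_contra! h
    have : x ∈ Ico a b ∩ spectrum ℝ A := ⟨⟨h, hxb⟩, hx⟩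
    rw [hgap] at this
    exact this
  by_contra! h
  refine hball (Metric.mem_ball.2 ?_) hx
  rw [Real.dist_eq, abs_lt]
  constructor <;> linarith

theorem exists_radius_of_phase {θ : ℝ → ℝ} {δ c : ℝ} (hδ : 0 < δ) (hc : 0 < c)
    (hθ_smooth : ContDiffOn ℝ 2 θ (Ioo (-δ) δ)) (hθ_deriv : ∀ k ∈ Ioo (-δ) δ, c ≤ deriv θ k)
    (hθ0 : θ 0 = 0) : ∃ r Λ : ℝ, 0 < r ∧ r ≤ δ ∧ 0 < Λ ∧
      (∀ k ∈ Ioo (-r) r, HasDerivAt θ (deriv θ k) k) ∧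
      (∀ k ∈ Ioo (-r) r, |θ k| ≤ Λ * |k|) ∧
      MapsTo θ (Ioo (-r) r) (Ioc (-Real.pi) Real.pi) := by
  have h0 : (0 : ℝ) ∈ Ioo (-δ) δ := ⟨by linarith, hδ⟩
  have hdiff : ∀ k ∈ Ioo (-δ) δ, HasDerivAt θ (deriv θ k) k := fun k hk =>
    ((hθ_smooth.differentiableOn (by norm_num)).differentiableAt
      (isOpen_Ioo.mem_nhds hk)).hasDerivAt
  have hcont : ContinuousAt (deriv θ) 0 :=
    (hθ_smooth.continuousOn_deriv_of_isOpen isOpen_Ioo (by norm_num)).continuousAt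
      (isOpen_Ioo.mem_nhds h0)
  set Λ := deriv θ 0 + 1 with hΛ
  have hΛ0 : 0 < Λ := by
    have := hθ_deriv 0 h0
    linarith
  obtain ⟨s, hs, hball⟩ := Metric.continuousAt_iff.1 hcont 1 one_pos
  -- The derivative of `θ` stays below `Λ` within distance `s` of 0, and `r ≤ π / Λ` keeps `θ`
  -- inside one period.
  set r := min δ (min s (Real.pi / Λ)) with hr
  have hr0 : 0 < r := by
    have := Real.pi_pos
    positivity
  have hrδ : r ≤ δ := min_le_left _ _
  have hrs : r ≤ s := (min_le_right _ _).trans (min_le_left _ _)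
  have hrπ : r ≤ Real.pi / Λ := (min_le_right _ _).trans (min_le_right _ _)
  have hsub : Ioo (-r) r ⊆ Ioo (-δ) δ := Ioo_subset_Ioo (by linarith) hrδ
  have hlip : ∀ k ∈ Ioo (-r) r, |θ k| ≤ Λ * |k| := by
    intro k hk
    have h := (convex_Ioo (-r) r).norm_image_sub_le_of_norm_deriv_le (f := θ) (C := Λ)
      (x := 0) (y := k) (fun x hx => (hdiff x (hsub hx)).differentiableAt) (fun x hx => ?_)
      ⟨by linarith, hr0⟩ hk
    · simpa [hθ0] using h
    · have h1 : 0 ≤ deriv θ x := hc.le.trans (hθ_deriv x (hsub hx))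
      rw [Real.norm_of_nonneg h1]
      have h2 : dist x 0 < s := by
        rw [Real.dist_eq, sub_zero]
        exact (abs_lt.2 hx).trans_le hrs
      have h3 := hball h2
      rw [Real.dist_eq] at h3
      have := (abs_lt.1 h3).2
      linarith
  refine ⟨r, Λ, hr0, hrδ, hΛ0, fun k hk => hdiff k (hsub hk), hlip, fun k hk => ?_⟩
  have h1 : |θ k| < Real.pi := by
    calc |θ k| ≤ Λ * |k| := hlip k hk
      _ < Λ * r := by
        have := abs_lt.2 hk
        gcongr
      _ ≤ Λ * (Real.pi / Λ) := by gcongr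
      _ = Real.pi := by field_simp
  exact ⟨(abs_lt.1 h1).1, (abs_lt.1 h1).2.le⟩

theorem summable_mul_ellTwo_sq {d : ℤ → ℝ} (hd : ∀ n, 0 ≤ d n) (hds : Summable d) (φ : EllTwo) :
    Summable fun n => d n * ‖φ n‖ ^ 2 := by
  refine Summable.of_nonneg_of_le (fun n => mul_nonneg (hd n) (by positivity)) (fun n => ?_)
    (hds.mul_right (‖φ‖ ^ 2))
  refine mul_le_mul_of_nonneg_left ?_ (hd n)
  gcongr
  exact ellTwo_norm_apply_le φ n

theorem exists_orthogonal_ellTwo {d : ℤ → ℝ} (hd : ∀ n, 0 ≤ d n) (hds : Summable d) {η : ℝ}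
    (hη : 0 < η) : ∃ (n : ℕ) (f : Fin n → EllTwo), (n : ℝ) ≤ η⁻¹ * ∑' n, d n ∧
      ∀ h : EllTwo, (∀ i, inner ℂ (f i) h = 0) → ∑' n, d n * ‖h n‖ ^ 2 ≤ η * ‖h‖ ^ 2 := by
  obtain ⟨n, f, hn, hf⟩ := exists_orthogonal_tsum_le hd hds
    (fun n => (lp.single 2 n (1 : ℂ) : EllTwo)) (K := 1) (fun n => by
      rw [lp.norm_single (by norm_num)]
      norm_num) hη
  refine ⟨n, f, ?_, fun h hh => ?_⟩
  · rw [← div_eq_inv_mul, le_div_iff₀ hη]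
    linarith
  · have := hf h hh
    have e : ∀ n, inner ℂ (lp.single 2 n (1 : ℂ) : EllTwo) h = h n := fun n => by
      rw [lp.inner_single_left]
      simp
    simpa only [e] using this

theorem exists_functionals_on_spectralRangeIco {A : EllTwo →L[ℂ] EllTwo} (hA : IsSelfAdjoint A)
    {b ε δ : ℝ} (hδ : 0 < δ) {ρ θ E : ℝ → ℝ} {u : ℤ → ℝ → ℂ}
    (hρ_meas : AEStronglyMeasurable ρ (volume.restrict (Ioo (-δ) δ)))
    (hu_meas : ∀ n, AEStronglyMeasurable (u n) (volume.restrict (Ioo (-δ) δ)))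
    (T : spectralRangeIco A b (b + ε) →ₗ[ℂ] Lp ℂ 2 (volume.restrict (Ioo (-δ) δ)))
    (hT_expand : ∀ φ : spectralRangeIco A b (b + ε), ∀ n : ℤ,
      (φ : EllTwo) n = ∫ k in Ioo (-δ) δ, T φ k * u n k)
    (hT_diag : ∀ φ ψ : spectralRangeIco A b (b + ε), (ψ : EllTwo) = A (φ : EllTwo) →
        ∀ᵐ k ∂(volume.restrict (Ioo (-δ) δ)), T ψ k = (E k : ℂ) * T φ k)
    (hT_norm : ∀ φ : spectralRangeIco A b (b + ε),
      ‖(φ : EllTwo)‖ ^ 2 = ∫ k in Ioo (-δ) δ, ‖T φ k‖ ^ 2 * ρ k)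
    (hρ : ∃ ρm ρp : ℝ, 0 < ρm ∧ ∀ k ∈ Ioo (-δ) δ, ρm ≤ ρ k ∧ ρ k ≤ ρp)
    (hE_lower : ∃ c₁ > 0, ∀ k ∈ Ioo (-δ) δ, b + c₁ * k ^ 2 ≤ E k)
    (hu_bdd : ∃ c₂ : ℝ, ∀ k ∈ Ioo (-δ) δ, ∀ n, ‖u n k‖ ≤ c₂)
    {v : ℤ → ℝ → ℂ}
    (hv : ∀ n, ∀ k ∈ Ioo (-δ) δ,
      v n k = Complex.exp (-(Complex.I * (θ k : ℂ) * (n : ℂ))) * u n k)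
    (hv_lip : ∃ c₃ : ℝ, ∀ k ∈ Ioo (-δ) δ, ∀ n, ‖v n k - v n 0‖ ≤ c₃ * k ^ 2)
    (hθ_smooth : ContDiffOn ℝ 2 θ (Ioo (-δ) δ))
    (hθ_deriv : ∃ c > 0, ∀ k ∈ Ioo (-δ) δ, c ≤ deriv θ k) (hθ0 : θ 0 = 0) :
    ∃ C₁ C₂ : ℝ, 0 ≤ C₁ ∧ 0 ≤ C₂ ∧
      ∀ d : ℤ → ℝ, (∀ n, 0 ≤ d n) → Summable d → ∀ t₀ : ℝ, 0 < t₀ →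
      ∃ (N : ℕ) (f : Fin N → (spectralRangeIco A b (b + ε) →ₗ[ℂ] ℂ))
        (l : List (ℝ × (spectralRangeIco A b (b + ε) →ₗ[ℂ] ℂ))),
        (N : ℝ) ≤ C₁ * ∑' n, d n ∧ (∀ x ∈ l, 0 ≤ x.1) ∧
        (l.map fun x => x.1).sum ≤ C₂ * ∑' n, d n ∧
        ∀ t, t₀ ≤ t → ∀ φ : spectralRangeIco A b (b + ε),
          (∀ i, f i φ = 0) → (∀ x ∈ l, t ≤ x.1 → x.2 φ = 0) →
          b * ‖(φ : EllTwo)‖ ^ 2 + 2 * ∑' n, d n * ‖(φ : EllTwo) n‖ ^ 2 ≤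
            (inner ℂ (φ : EllTwo) (A φ)).re + t ^ 2 / 2 * ‖(φ : EllTwo)‖ ^ 2 := by
  obtain ⟨ρm, ρp, hρm, hρ⟩ := hρ
  obtain ⟨c₁, hc₁, hE⟩ := hE_lower
  obtain ⟨c₂, hu⟩ := hu_bdd
  obtain ⟨c₃, hv3⟩ := hv_lip
  obtain ⟨c, hc, hθ'⟩ := hθ_deriv
  obtain ⟨r, Λ, hr, hrδ, hΛ, hθd, hθΛ, hmaps⟩ :=
    exists_radius_of_phase hδ hc hθ_smooth hθ' hθ0
  have hsub : Ioo (-r) r ⊆ Ioo (-δ) δ := Ioo_subset_Ioo (by linarith) hrδ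
  have h0 : (0 : ℝ) ∈ Ioo (-δ) δ := ⟨by linarith, hδ⟩
  have hv0 : ∀ n, v n 0 = u n 0 := fun n => by
    rw [hv n 0 h0, hθ0]
    simp
  have huv : ∀ k ∈ Ioo (-r) r, ∀ n,
      ‖u n k - v n 0 * Complex.exp (Complex.I * θ k * n)‖ ≤ |c₃| * k ^ 2 := by
    intro k hk n
    have h1 : u n k = Complex.exp (Complex.I * θ k * n) * v n k := by
      rw [hv n k (hsub hk), ← mul_assoc, ← Complex.exp_add, add_neg_cancel, Complex.exp_zero,
        one_mul]
    have h2 : u n k - v n 0 * Complex.exp (Complex.I * θ k * n) =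
        Complex.exp (Complex.I * θ k * n) * (v n k - v n 0) := by
      rw [h1]; ring
    rw [h2, norm_mul, norm_exp_I_mul_ofReal_mul_int, one_mul]
    refine (hv3 k (hsub hk) n).trans ?_
    gcongr
    exact le_abs_self _
  have hc₂' : c₂ ≤ |c₂| + 1 := by linarith [le_abs_self c₂]
  -- After doubling, `α` uses exactly the kinetic term of `energy_of_transform`, and `β` gives `t² /
  -- 2` by its norm bound.
  obtain ⟨C₁, C₂, hC₁, hC₂, hmain⟩ := exists_functionals_of_expansion hr hrδ hu_meas
    (c₂ := |c₂| + 1) (by positivity) (fun k hk n => (hu k hk n).trans hc₂')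
    (v₀ := fun n => v n 0) (fun n => by rw [hv0]; exact (hu 0 h0 n).trans hc₂') hc hθd
    (fun k hk => hθ' k (hsub hk)) hmaps hΛ hθΛ (abs_nonneg c₃) huv
    (α := c₁ * ρm / 2) (β := ρm / 4) (by positivity) (by positivity)
  refine ⟨C₁, C₂, hC₁, hC₂, fun d hd hds t₀ ht₀ => ?_⟩
  obtain ⟨N, f, l, hN, hl0, hl1, hfl⟩ := hmain d hd hds t₀ ht₀
  refine ⟨N, fun i => f i ∘ₗ T, l.map fun x => (x.1, x.2 ∘ₗ T), hN, ?_, ?_, ?_⟩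
  · intro x hx
    obtain ⟨y, hy, rfl⟩ := List.mem_map.1 hx
    exact hl0 y hy
  · rw [List.map_map]
    exact hl1
  · intro t ht φ hf hl
    obtain ⟨he1, he2⟩ := energy_of_transform hA hρ_meas T hT_diag hT_norm hρm hρ hc₁ hE φ
    have h1 := hfl t ht (T φ) hf fun x hx htx =>
      hl (x.1, x.2 ∘ₗ T) (List.mem_map.2 ⟨x, hx, rfl⟩) htx
    simp_rw [← hT_expand φ] at h1
    have h2 : t ^ 2 / 2 * (ρm * ∫ k in Ioo (-δ) δ, ‖T φ k‖ ^ 2) ≤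
        t ^ 2 / 2 * ‖(φ : EllTwo)‖ ^ 2 := by gcongr
    linarith

/-- Three spectral pieces: below the gap (margin `η`), above `b + ε` (margin `ε`), and the range
treated by `hQ`. The last two form `q`; they are orthogonal and decoupled by `A`, but not by the
potential, hence the factor 2 in `hQ` and the choice `ε / 4`. -/
theorem exists_functionals_splitting {A : EllTwo →L[ℂ] EllTwo} (hA : IsSelfAdjoint A)
    {a b ε η : ℝ} (hε : 0 < ε) (hη : 0 < η)
    (hgap : ∀ x ∈ spectrum ℝ A, x < b → x ≤ a - η)
    {C₁ C₂ : ℝ} (hC₁ : 0 ≤ C₁)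
    (hQ : ∀ d : ℤ → ℝ, (∀ n, 0 ≤ d n) → Summable d → ∀ t₀ : ℝ, 0 < t₀ →
      ∃ (N : ℕ) (f : Fin N → (spectralRangeIco A b (b + ε) →ₗ[ℂ] ℂ))
        (l : List (ℝ × (spectralRangeIco A b (b + ε) →ₗ[ℂ] ℂ))),
        (N : ℝ) ≤ C₁ * ∑' n, d n ∧ (∀ x ∈ l, 0 ≤ x.1) ∧
        (l.map fun x => x.1).sum ≤ C₂ * ∑' n, d n ∧
        ∀ t, t₀ ≤ t → ∀ φ : spectralRangeIco A b (b + ε),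
          (∀ i, f i φ = 0) → (∀ x ∈ l, t ≤ x.1 → x.2 φ = 0) →
          b * ‖(φ : EllTwo)‖ ^ 2 + 2 * ∑' n, d n * ‖(φ : EllTwo) n‖ ^ 2 ≤
            (inner ℂ (φ : EllTwo) (A φ)).re + t ^ 2 / 2 * ‖(φ : EllTwo)‖ ^ 2) :
    ∃ C : ℝ, 0 ≤ C ∧
      ∀ d : ℤ → ℝ, (∀ n, 0 ≤ d n) → Summable d → ∀ t₀ : ℝ, 0 < t₀ →
      ∃ (κ : Type) (_ : Fintype κ) (f : κ → (EllTwo →ₗ[ℂ] ℂ)) (l : List (ℝ × (EllTwo →ₗ[ℂ] ℂ))),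
        (Fintype.card κ : ℝ) ≤ C * ∑' n, d n ∧ (∀ x ∈ l, 0 ≤ x.1) ∧
        (l.map fun x => x.1).sum ≤ C₂ * ∑' n, d n ∧
        ∀ t, t₀ ≤ t → ∀ φ : EllTwo, (∀ i, f i φ = 0) → (∀ x ∈ l, t ≤ x.1 → x.2 φ = 0) →
          ∃ p q : EllTwo, φ = p + q ∧ inner ℂ p q = 0 ∧
            (inner ℂ p (A p)).re + ∑' n, d n * ‖p n‖ ^ 2 ≤ (a - η / 2) * ‖p‖ ^ 2 ∧
            (b - t ^ 2 / 2) * ‖q‖ ^ 2 + ∑' n, d n * ‖q n‖ ^ 2 ≤ (inner ℂ q (A q)).re := by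
  set R := spectralRangeIci A b with hR
  set R₂ := spectralRangeIci A (b + ε) with hR₂
  have hR₂R : R₂ ≤ R := spectralRangeIci_antitone A (by linarith)
  let P : EllTwo →L[ℂ] EllTwo := R.starProjection
  let P₂ : EllTwo →L[ℂ] EllTwo := R₂.starProjection
  have hPmem : ∀ φ, P φ ∈ R := fun φ => R.starProjection_apply_mem φ
  have hP₂mem : ∀ φ, P₂ φ ∈ R₂ := fun φ => R₂.starProjection_apply_mem φ
  have hPo : ∀ φ, φ - P φ ∈ Rᗮ := fun φ => R.sub_starProjection_mem_orthogonal φ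
  have hP₂o : ∀ φ, φ - P₂ φ ∈ R₂ᗮ := fun φ => R₂.sub_starProjection_mem_orthogonal φ
  have hmem₁ : ∀ φ, (P - P₂) φ ∈ spectralRangeIco A b (b + ε) := by
    intro φ
    refine ⟨R.sub_mem (hPmem φ) (hR₂R (hP₂mem φ)), ?_⟩
    have h1 := Submodule.orthogonal_le hR₂R (hPo φ)
    have h2 := R₂ᗮ.sub_mem (hP₂o φ) h1
    have e : φ - P₂ φ - (φ - P φ) = (P - P₂) φ := by
      rw [sub_apply]
      abel
    rwa [e] at h2
  let P₁ : EllTwo →ₗ[ℂ] spectralRangeIco A b (b + ε) :=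
    (P - P₂).toLinearMap.codRestrict _ hmem₁
  refine ⟨(η / 2)⁻¹ + (ε / 4)⁻¹ + C₁, by positivity, fun d hd hds t₀ ht₀ => ?_⟩
  obtain ⟨N, f, l, hN, hl0, hl1, hfl⟩ := hQ d hd hds t₀ ht₀
  obtain ⟨n₁, f₁, hn₁, hf₁⟩ := exists_orthogonal_ellTwo hd hds (η := η / 2) (by positivity)
  obtain ⟨n₂, f₂, hn₂, hf₂⟩ := exists_orthogonal_ellTwo hd hds (η := ε / 4) (by positivity)
  refine ⟨Fin n₁ ⊕ Fin n₂ ⊕ Fin N, inferInstance,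
    Sum.elim (fun i => (innerSL ℂ (f₁ i)).toLinearMap ∘ₗ
      (ContinuousLinearMap.id ℂ EllTwo - P).toLinearMap)
      (Sum.elim (fun i => (innerSL ℂ (f₂ i)).toLinearMap ∘ₗ P₂.toLinearMap)
        (fun i => f i ∘ₗ P₁)), l.map fun x => (x.1, x.2 ∘ₗ P₁), ?_, ?_, ?_, ?_⟩
  · simp only [Fintype.card_sum, Fintype.card_fin]
    push_cast
    linarith
  · intro x hx
    obtain ⟨y, hy, rfl⟩ := List.mem_map.1 hx
    exact hl0 y hy
  · rw [List.map_map]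
    exact hl1
  · intro t ht φ hf hl
    set p := φ - P φ with hp
    set q₂ := P₂ φ with hq₂
    set q₁ := (P - P₂) φ with hq₁
    have hq₁' : ((P₁ φ : spectralRangeIco A b (b + ε)) : EllTwo) = q₁ := rfl
    have hq : P φ = q₁ + q₂ := by
      rw [hq₁, hq₂, sub_apply]
      abel
    have hp1 : ∑' n, d n * ‖p n‖ ^ 2 ≤ η / 2 * ‖p‖ ^ 2 :=
      hf₁ p fun i => hf (Sum.inl i)
    have hp2 := re_inner_le_of_mem_orthogonal_spectralRangeIci hA hgap (hPo φ)
    have hq21 : ∑' n, d n * ‖q₂ n‖ ^ 2 ≤ ε / 4 * ‖q₂‖ ^ 2 :=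
      hf₂ q₂ fun i => hf (Sum.inr (Sum.inl i))
    have hq22 := le_re_inner_of_mem_spectralRangeIci hA (hP₂mem φ)
    have hq1 := hfl t ht (P₁ φ) (fun i => hf (Sum.inr (Sum.inr i))) fun x hx htx =>
      hl (x.1, x.2 ∘ₗ P₁) (List.mem_map.2 ⟨x, hx, rfl⟩) htx
    rw [hq₁'] at hq1
    refine ⟨p, P φ, by rw [hp]; abel, ?_, by linarith, ?_⟩
    · exact Submodule.inner_left_of_mem_orthogonal (hPmem φ) (hPo φ)
    · have ho : inner ℂ q₁ q₂ = 0 :=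
        Submodule.inner_left_of_mem_orthogonal (hP₂mem φ) (hmem₁ φ).2
      have ho1 : inner ℂ q₁ (A q₂) = 0 :=
        Submodule.inner_left_of_mem_orthogonal (map_mem_spectralRangeIci (hP₂mem φ)) (hmem₁ φ).2
      have ho2 : inner ℂ q₂ (A q₁) = 0 :=
        Submodule.inner_right_of_mem_orthogonal (hP₂mem φ)
          (map_mem_orthogonal_spectralRangeIci hA (hmem₁ φ).2)
      have hn : ‖P φ‖ ^ 2 = ‖q₁‖ ^ 2 + ‖q₂‖ ^ 2 := by
        rw [hq, norm_add_sq (𝕜 := ℂ), ho]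
        simp
      have hA' : (inner ℂ (P φ) (A (P φ))).re =
          (inner ℂ q₁ (A q₁)).re + (inner ℂ q₂ (A q₂)).re := by
        rw [hq, map_add, inner_add_left, inner_add_right, inner_add_right, ho1, ho2]
        simp
      have hs₁ := summable_mul_ellTwo_sq hd hds q₁
      have hs₂ := summable_mul_ellTwo_sq hd hds q₂
      have hdq : ∑' n, d n * ‖P φ n‖ ^ 2 ≤
          2 * ∑' n, d n * ‖q₁ n‖ ^ 2 + 2 * ∑' n, d n * ‖q₂ n‖ ^ 2 := by
        rw [← tsum_mul_left, ← tsum_mul_left, ← (hs₁.mul_left 2).tsum_add (hs₂.mul_left 2)]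
        refine Summable.tsum_le_tsum (fun n => ?_) (summable_mul_ellTwo_sq hd hds _)
          ((hs₁.mul_left 2).add (hs₂.mul_left 2))
        have h1 : ‖P φ n‖ ^ 2 ≤ 2 * (‖q₁ n‖ ^ 2 + ‖q₂ n‖ ^ 2) := by
          rw [hq]
          calc _ ≤ (‖q₁ n‖ + ‖q₂ n‖) ^ 2 := by
                gcongr
                exact norm_add_le _ _
            _ ≤ _ := add_sq_le
        calc _ ≤ d n * (2 * (‖q₁ n‖ ^ 2 + ‖q₂ n‖ ^ 2)) := mul_le_mul_of_nonneg_left h1 (hd n)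
          _ = _ := by ring
      have ht2 : 0 ≤ t ^ 2 / 2 * ‖q₂‖ ^ 2 := by positivity
      have hε2 : 0 ≤ ε / 2 * ‖q₂‖ ^ 2 := by positivity
      rw [hn, hA']
      linarith

/-! ### Counting eigenvalues and the final bound -/

/-- If more eigenvalues lay at level `t` than functionals are in force there, some nonzero
combination of their eigenvectors would be annihilated by all of these and would split as excluded
by `eq_zero_of_sum_eigenvectors`. -/
theorem sum_sqrt_le_of_splitting {a b : ℝ} {C : EllTwo →L[ℂ] EllTwo} (hC : IsSelfAdjoint C)
    {ι κ : Type*} [Fintype ι] [Fintype κ] {φ : ι → EllTwo} (hφ : Orthonormal ℂ φ) {ev : ι → ℝ}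
    (hev : ∀ i, C (φ i) = (ev i : ℂ) • φ i) (hIoo : ∀ i, ev i ∈ Ioo a b) {t₀ : ℝ} (ht₀ : 0 < t₀)
    (ht₀' : ∀ i, t₀ ≤ Real.sqrt (b - ev i))
    (f : κ → (EllTwo →ₗ[ℂ] ℂ)) (l : List (ℝ × (EllTwo →ₗ[ℂ] ℂ))) (hl : ∀ x ∈ l, 0 ≤ x.1)
    (hsplit : ∀ t, t₀ ≤ t → ∀ φ : EllTwo, (∀ i, f i φ = 0) → (∀ x ∈ l, t ≤ x.1 → x.2 φ = 0) →
      ∃ p q : EllTwo, φ = p + q ∧ inner ℂ p q = 0 ∧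
        (p ≠ 0 → (inner ℂ p (C p)).re < a * ‖p‖ ^ 2) ∧
        (q ≠ 0 → (b - t ^ 2) * ‖q‖ ^ 2 < (inner ℂ q (C q)).re)) :
    ∑ i, Real.sqrt (b - ev i) ≤
      Fintype.card κ * Real.sqrt (b - a) + (l.map fun x => x.1).sum := by
  classical
  have hcount : ∀ t, t₀ ≤ t → (Finset.univ.filter fun i => t ≤ Real.sqrt (b - ev i)).card ≤
      Fintype.card κ + (Finset.univ.filter fun j : Fin l.length => t ≤ (l.get j).1).card := by
    intro t ht
    by_contra! hlt
    let ι' := {i // t ≤ Real.sqrt (b - ev i)}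
    let κ' := κ ⊕ {j : Fin l.length // t ≤ (l.get j).1}
    have hcard : Fintype.card κ' < Fintype.card ι' := by
      simpa [κ', ι', Fintype.card_subtype] using hlt
    obtain ⟨x, hx, hx0⟩ := exists_ne_zero_forall_eq_zero (fun i : ι' => φ i)
      (Sum.elim f fun j : {j : Fin l.length // t ≤ (l.get j).1} => (l.get j).2 : κ' → _) hcard
    obtain ⟨p, q, hpq, horth, hp, hq⟩ := hsplit t ht (∑ i, x i • φ i) (fun i => hx0 (Sum.inl i))
      fun y hy hty => by
        obtain ⟨j, rfl⟩ := List.get_of_mem hy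
        exact hx0 (Sum.inr ⟨j, hty⟩)
    refine hx (eq_zero_of_sum_eigenvectors hC (hφ.comp _ Subtype.val_injective)
      (fun i : ι' => hev i) (fun i => ⟨(hIoo i).1.le, ?_⟩) hpq horth hp hq)
    have h1 := i.2
    have h2 : t ^ 2 ≤ b - ev i := by
      have h3 : 0 ≤ b - ev i := by linarith [(hIoo i).2]
      calc t ^ 2 ≤ Real.sqrt (b - ev i) ^ 2 := by
            have := ht₀.le.trans ht
            gcongr
        _ = _ := Real.sq_sqrt h3
    linarith
  have hget : (l.map fun x => x.1).sum = ∑ j : Fin l.length, (l.get j).1 :=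
    (Fin.sum_univ_fun_getElem l fun x => x.1).symm
  rw [hget]
  refine sum_le_of_card_filter_le Finset.univ _ Finset.univ _ (Real.sqrt_nonneg _)
    (fun i _ => ⟨Real.sqrt_nonneg _, Real.sqrt_le_sqrt (by linarith [(hIoo i).1])⟩)
    (fun j _ => hl _ (List.get_mem l j)) fun t ht => ?_
  -- Every eigenvalue has level at least `t₀`, so lower values of `t` may be raised to `t₀` without
  -- changing the count.
  have h1 := hcount (max t t₀) (le_max_right _ _)
  have h2 : (Finset.univ.filter fun i => t ≤ Real.sqrt (b - ev i)).card ≤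
      (Finset.univ.filter fun i => max t t₀ ≤ Real.sqrt (b - ev i)).card :=
    Finset.card_le_card fun i hi => by
      simp only [Finset.mem_filter, Finset.mem_univ, true_and] at hi ⊢
      exact max_le hi (ht₀' i)
  have h3 : (Finset.univ.filter fun j : Fin l.length => max t t₀ ≤ (l.get j).1).card ≤
      (Finset.univ.filter fun j : Fin l.length => t ≤ (l.get j).1).card :=
    Finset.card_le_card fun i hi => by
      simp only [Finset.mem_filter, Finset.mem_univ, true_and] at hi ⊢
      exact (le_max_left _ _).trans hi
  exact_mod_cast h2.trans (h1.trans (by omega))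

theorem exists_const_sum_sqrt_le {a b : ℝ} {A : EllTwo →L[ℂ] EllTwo}
    (hA : IsSelfAdjoint A) {η C C₂ : ℝ} (hη : 0 < η)
    (hsplit : ∀ d : ℤ → ℝ, (∀ n, 0 ≤ d n) → Summable d → ∀ t₀ : ℝ, 0 < t₀ →
      ∃ (κ : Type) (_ : Fintype κ) (f : κ → (EllTwo →ₗ[ℂ] ℂ)) (l : List (ℝ × (EllTwo →ₗ[ℂ] ℂ))),
        (Fintype.card κ : ℝ) ≤ C * ∑' n, d n ∧ (∀ x ∈ l, 0 ≤ x.1) ∧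
        (l.map fun x => x.1).sum ≤ C₂ * ∑' n, d n ∧
        ∀ t, t₀ ≤ t → ∀ φ : EllTwo, (∀ i, f i φ = 0) → (∀ x ∈ l, t ≤ x.1 → x.2 φ = 0) →
          ∃ p q : EllTwo, φ = p + q ∧ inner ℂ p q = 0 ∧
            (inner ℂ p (A p)).re + ∑' n, d n * ‖p n‖ ^ 2 ≤ (a - η / 2) * ‖p‖ ^ 2 ∧
            (b - t ^ 2 / 2) * ‖q‖ ^ 2 + ∑' n, d n * ‖q n‖ ^ 2 ≤ (inner ℂ q (A q)).re)
    {δa δb : ℤ → ℝ} (hδa : BddSeq δa) (hδb : BddSeq δb) (hsa : Summable fun n => |δa n|)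
    (hsb : Summable fun n => |δb n|)
    {ι : Type*} [Fintype ι] {φ : ι → EllTwo} (hφ : Orthonormal ℂ φ) {ev : ι → ℝ}
    (hev : ∀ i, (A + jacobiOp δa δb hδa hδb) (φ i) = (ev i : ℂ) • φ i)
    (hIoo : ∀ i, ev i ∈ Ioo a b) :
    ∑ i, Real.sqrt (b - ev i) ≤
      (C * Real.sqrt (b - a) + C₂) * (∑' n, |δb n| + 2 * ∑' n, |δa n|) := by
  set d : ℤ → ℝ := fun n => |δb n| + |δa n| + |δa (n - 1)| with hd
  have hd0 : ∀ n, 0 ≤ d n := fun n => by positivity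
  have hsa' : Summable fun n => |δa (n - 1)| := (Equiv.subRight (1 : ℤ)).summable_iff.mpr hsa
  have hds : Summable d := (hsb.add hsa).add hsa'
  have hdsum : ∑' n, d n = ∑' n, |δb n| + 2 * ∑' n, |δa n| := by
    have e : ∑' n, |δa (n - 1)| = ∑' n, |δa n| :=
      (Equiv.subRight (1 : ℤ)).tsum_eq fun n => |δa n|
    rw [hd, (hsb.add hsa).tsum_add hsa', hsb.tsum_add hsa, e]
    ring
  set B := jacobiOp δa δb hδa hδb with hB
  have hBd : ∀ z : EllTwo, |(inner ℂ z (B z)).re| ≤ ∑' n, d n * ‖z n‖ ^ 2 :=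
    re_inner_jacobiOp_le δa δb hδa hδb
  have hAB : IsSelfAdjoint (A + B) := hA.add (jacobiOp_isSelfAdjoint _ _ _ _)
  have hpos : ∀ i, 0 < Real.sqrt (b - ev i) := fun i =>
    Real.sqrt_pos.2 (by linarith [(hIoo i).2])
  -- Finitely many eigenvalues strictly below `b` have a positive smallest level; the final
  -- constants do not depend on it.
  obtain ⟨t₀, ht₀, ht₀'⟩ : ∃ t₀ > 0, ∀ i, t₀ ≤ Real.sqrt (b - ev i) := by
    rcases isEmpty_or_nonempty ι with h | h
    · exact ⟨1, one_pos, fun i => h.elim i⟩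
    · obtain ⟨i, hi⟩ := Finite.exists_min fun i => Real.sqrt (b - ev i)
      exact ⟨_, hpos i, hi⟩
  obtain ⟨κ, _, f, l, hκ, hl0, hl1, hfl⟩ := hsplit d hd0 hds t₀ ht₀
  have hadd : ∀ z : EllTwo, (inner ℂ z ((A + B) z)).re =
      (inner ℂ z (A z)).re + (inner ℂ z (B z)).re := fun z => by
    rw [add_apply, inner_add_right, Complex.add_re]
  have hmain := sum_sqrt_le_of_splitting hAB hφ hev hIoo ht₀ ht₀' f l hl0
    fun t ht φ hf hlφ => by
      obtain ⟨p, q, h1, h2, h3, h4⟩ := hfl t ht φ hf hlφ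
      refine ⟨p, q, h1, h2, fun hp => ?_, fun hq => ?_⟩
      · have h5 := (abs_le.1 (hBd p)).2
        have h6 : 0 < ‖p‖ := norm_pos_iff.2 hp
        have h7 : 0 < η / 2 * ‖p‖ ^ 2 := by positivity
        rw [hadd]
        linarith
      · have h5 := (abs_le.1 (hBd q)).1
        have h6 : 0 < ‖q‖ := norm_pos_iff.2 hq
        have ht0 : 0 < t := ht₀.trans_le ht
        have h7 : 0 < t ^ 2 / 2 * ‖q‖ ^ 2 := by positivity
        rw [hadd]
        linarith
  rw [← hdsum]
  have h1 := mul_le_mul_of_nonneg_right hκ (Real.sqrt_nonneg (b - a))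
  linarith

/-- It suffices to bound finite partial sums, where orthonormal bases of the eigenspaces combine
into one orthonormal family. -/
theorem tsum_discreteSpectrum_le {A : EllTwo →L[ℂ] EllTwo} (hA : IsSelfAdjoint A) {a b K : ℝ}
    (hK : ∀ (ι : Type) [Fintype ι] (φ : ι → EllTwo) (ev : ι → ℝ), Orthonormal ℂ φ →
      (∀ i, A (φ i) = (ev i : ℂ) • φ i) → (∀ i, ev i ∈ Ioo a b) →
      ∑ i, Real.sqrt (b - ev i) ≤ K) :
    ∑' e : ↥(discreteSpectrum A ∩ Ioo a b),
      (eigenMultiplicity A (e : ℝ) : ℝ≥0∞) * ENNReal.ofReal (Real.sqrt (b - (e : ℝ))) ≤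
        ENNReal.ofReal K := by
  rw [ENNReal.tsum_eq_iSup_sum]
  refine iSup_le fun s => ?_
  let V : ↥s → Submodule ℂ EllTwo := fun e =>
    Module.End.eigenspace A.toLinearMap (((e : ↥(discreteSpectrum A ∩ Ioo a b)) : ℝ) : ℂ)
  have hfd : ∀ e : ↥s, FiniteDimensional ℂ (V e) := fun e => e.1.2.1.2.2
  have hinj : Function.Injective fun e : ↥s =>
      (((e : ↥(discreteSpectrum A ∩ Ioo a b)) : ℝ) : ℂ) :=
    Complex.ofReal_injective.comp (Subtype.val_injective.comp Subtype.val_injective)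
  have horth : OrthogonalFamily ℂ (fun e => V e) fun e => (V e).subtypeₗᵢ :=
    hA.isSymmetric.orthogonalFamily_eigenspaces.comp hinj
  have hon := horth.orthonormal_sigma_orthonormal
    (v_family := fun e => stdOrthonormalBasis ℂ (V e)) fun e =>
      (stdOrthonormalBasis ℂ (V e)).orthonormal
  have h := hK _ _ (fun i => ((i.1 : ↥(discreteSpectrum A ∩ Ioo a b)) : ℝ)) hon
    (fun i => Module.End.mem_eigenspace_iff.1 (stdOrthonormalBasis ℂ (V i.1) i.2).2)
    fun i => i.1.1.2.2
  rw [Fintype.sum_sigma] at h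
  simp only [Finset.sum_const, Finset.card_univ, Fintype.card_fin, nsmul_eq_mul] at h
  refine le_trans (le_of_eq ?_) (ENNReal.ofReal_le_ofReal h)
  rw [ENNReal.ofReal_sum_of_nonneg fun e _ =>
      mul_nonneg (Nat.cast_nonneg _) (Real.sqrt_nonneg _),
    ← Finset.sum_coe_sort s]
  refine Finset.sum_congr rfl fun e _ => ?_
  rw [ENNReal.ofReal_mul (Nat.cast_nonneg _), ENNReal.ofReal_natCast]
  rfl

theorem theorem4p4
    -- the unperturbed Jacobi matrix `J₀`, with bounded parameters `a₀ n > 0` and `b₀ n`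
    (a₀ b₀ : ℤ → ℝ) (ha₀ : BddSeq a₀) (hb₀ : BddSeq b₀) (ha₀_pos : ∀ n, 0 < a₀ n)
    -- (i) the gap
    (a b : ℝ) (hab : a < b)
    (hgap : Ico a b ∩ spectrum ℝ (jacobiOp a₀ b₀ ha₀ hb₀) = ∅)
    -- (ii) the eigenfunction expansion near `b`; `T φ` is the transform of `φ`
    (ε δ : ℝ) (hε : 0 < ε) (hδ : 0 < δ)
    (ρ θ E : ℝ → ℝ) (u : ℤ → ℝ → ℂ)
    (hρ_meas : AEStronglyMeasurable ρ (volume.restrict (Ioo (-δ) δ)))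
    (hE_meas : AEStronglyMeasurable E (volume.restrict (Ioo (-δ) δ)))
    (hu_meas : ∀ n, AEStronglyMeasurable (u n) (volume.restrict (Ioo (-δ) δ)))
    (T : spectralRangeIco (jacobiOp a₀ b₀ ha₀ hb₀) b (b + ε) →ₗ[ℂ]
      Lp ℂ 2 (volume.restrict (Ioo (-δ) δ)))
    (hT_expand : ∀ φ : spectralRangeIco (jacobiOp a₀ b₀ ha₀ hb₀) b (b + ε), ∀ n : ℤ,
      (φ : EllTwo) n = ∫ k in Ioo (-δ) δ, T φ k * u n k)
    (hT_diag : ∀ φ ψ : spectralRangeIco (jacobiOp a₀ b₀ ha₀ hb₀) b (b + ε),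
      (ψ : EllTwo) = jacobiOp a₀ b₀ ha₀ hb₀ (φ : EllTwo) →
        ∀ᵐ k ∂(volume.restrict (Ioo (-δ) δ)), T ψ k = (E k : ℂ) * T φ k)
    (hT_norm : ∀ φ : spectralRangeIco (jacobiOp a₀ b₀ ha₀ hb₀) b (b + ε),
      ‖(φ : EllTwo)‖ ^ 2 = ∫ k in Ioo (-δ) δ, ‖T φ k‖ ^ 2 * ρ k)
    (hT_synth : ∀ f : Lp ℂ 2 (volume.restrict (Ioo (-δ) δ)),
      ∃ φ ∈ spectralRangeIco (jacobiOp a₀ b₀ ha₀ hb₀) b (b + ε), ∀ n : ℤ,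
        φ n = ∫ k in Ioo (-δ) δ, f k * u n k)
    -- (iii)
    (hρ : ∃ ρm ρp : ℝ, 0 < ρm ∧ ∀ k ∈ Ioo (-δ) δ, ρm ≤ ρ k ∧ ρ k ≤ ρp)
    -- (iv)
    (hE_maps : MapsTo E (Ico 0 δ) (Ico b (b + ε)))
    (hE_lower : ∃ c₁ > 0, ∀ k ∈ Ioo (-δ) δ, b + c₁ * k ^ 2 ≤ E k)
    -- (v)
    (hu_bdd : ∃ c₂ : ℝ, ∀ k ∈ Ioo (-δ) δ, ∀ n, ‖u n k‖ ≤ c₂)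
    -- (vi)
    (v : ℤ → ℝ → ℂ)
    (hv : ∀ n, ∀ k ∈ Ioo (-δ) δ,
      v n k = Complex.exp (-(Complex.I * (θ k : ℂ) * (n : ℂ))) * u n k)
    (hv_lip : ∃ c₃ : ℝ, ∀ k ∈ Ioo (-δ) δ, ∀ n, ‖v n k - v n 0‖ ≤ c₃ * k ^ 2)
    -- (vii)
    (hθ_smooth : ContDiffOn ℝ 2 θ (Ioo (-δ) δ))
    (hθ_deriv : ∃ c > 0, ∀ k ∈ Ioo (-δ) δ, c ≤ deriv θ k)
    -- (viii)
    (hE_even : ∀ k ∈ Ioo (-δ) δ, E (-k) = E k)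
    (hu_conj : ∀ n, ∀ k ∈ Ioo (-δ) δ, u n (-k) = star (u n k))
    (hθ_odd : ∀ k ∈ Ioo (-δ) δ, θ (-k) = -θ k)
    (hρ_even : ∀ k ∈ Ioo (-δ) δ, ρ (-k) = ρ k) :
    ∃ C : ℝ≥0, ∀ (δa δb : ℤ → ℝ) (hδa : BddSeq δa) (hδb : BddSeq δb),
      ∑' e : ↥(discreteSpectrum (jacobiOp a₀ b₀ ha₀ hb₀ + jacobiOp δa δb hδa hδb) ∩ Ioo a b),
          (eigenMultiplicity (jacobiOp a₀ b₀ ha₀ hb₀ + jacobiOp δa δb hδa hδb) (e : ℝ) : ℝ≥0∞) *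
            ENNReal.ofReal (Real.sqrt (b - (e : ℝ)))
        ≤ (C : ℝ≥0∞) * ∑' n : ℤ, ENNReal.ofReal (|δa n| + |δb n|) := by
  have hA := jacobiOp_isSelfAdjoint a₀ b₀ ha₀ hb₀
  have hθ0 : θ 0 = 0 := by
    have h := hθ_odd 0 ⟨by linarith, hδ⟩
    rw [neg_zero] at h
    linarith
  obtain ⟨η, hη, hη'⟩ := exists_gap_left hab hgap
  obtain ⟨C₁, C₂, hC₁, hC₂, hQ⟩ := exists_functionals_on_spectralRangeIco hA hδ hρ_meas hu_meas T
    hT_expand hT_diag hT_norm hρ hE_lower hu_bdd hv hv_lip hθ_smooth hθ_deriv hθ0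
  obtain ⟨C, hC, hsplit⟩ := exists_functionals_splitting hA hε hη hη' hC₁ hQ
  set K := (C * Real.sqrt (b - a) + C₂) * 2 with hK
  have hK0 : 0 ≤ K := by positivity
  -- Adding 1 makes the constant nonzero, so that its product with an infinite right-hand side is
  -- `⊤` and not 0.
  refine ⟨(K + 1).toNNReal, fun δa δb hδa hδb => ?_⟩
  by_cases hfin : ∑' n : ℤ, ENNReal.ofReal (|δa n| + |δb n|) = ⊤
  · rw [hfin, ENNReal.mul_top]
    · exact le_top
    · rw [ENNReal.coe_ne_zero, ne_eq, Real.toNNReal_eq_zero]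
      linarith
  have hsum : Summable fun n => |δa n| + |δb n| := by
    have h := ENNReal.summable_toReal hfin
    refine h.congr fun n => ?_
    rw [ENNReal.toReal_ofReal (by positivity)]
  have hsa : Summable fun n => |δa n| :=
    hsum.of_nonneg_of_le (fun n => abs_nonneg _) fun n => by linarith [abs_nonneg (δb n)]
  have hsb : Summable fun n => |δb n| :=
    hsum.of_nonneg_of_le (fun n => abs_nonneg _) fun n => by linarith [abs_nonneg (δa n)]
  have hAB := hA.add (jacobiOp_isSelfAdjoint δa δb hδa hδb)
  refine (tsum_discreteSpectrum_le hAB (K := (K + 1) * ∑' n, (|δa n| + |δb n|))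
    fun ι _ φ ev hφ hev hIoo => ?_).trans (le_of_eq ?_)
  · refine (exists_const_sum_sqrt_le hA hη hsplit hδa hδb hsa hsb hφ hev hIoo).trans ?_
    have ha0 : 0 ≤ ∑' n, |δa n| := tsum_nonneg fun n => abs_nonneg _
    have hb0 : 0 ≤ ∑' n, |δb n| := tsum_nonneg fun n => abs_nonneg _
    have hD : 0 ≤ C * Real.sqrt (b - a) + C₂ := by positivity
    rw [hsa.tsum_add hsb]
    have h1 := mul_nonneg hD hb0
    rw [hK]
    linarith
  · rw [ENNReal.ofReal_mul (by linarith), ENNReal.ofReal_tsum_of_nonneg (fun n => by positivity) hsum]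
    rfl
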